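/- **Definitions.** Let $(\mathcal A,\otimes,\mathbf 1,\alpha,\lambda,\rho)$ be a monoidal category with a braiding $\sigma_{X,Y}\colon X\otimes Y\cong Y\otimes X$. An *anti-involution* of $\mathcal A$ is a functor $\Phi\colon\mathcal A\to\mathcal A$ with natural isomorphisms $(\Phi_2)_{X,Y}\colon \Phi(Y)\otimes\Phi(X)\cong\Phi(X\otimes Y)$ and $\Phi_0\colon\Phi(\mathbf 1)\cong\mathbf 1$ making it a monoidal functor from $\mathcal A$ to $\mathcal A$ with reversed tensor product, together with a monoidal natural isomorphism $t\colon\Phi^2\cong\mathrm{id}_{\mathcal A}$ such that $\Phi(t_X)=t_{\Phi(X)}$. It is *braided* if $\Phi(\sigma_{X,Y})\circ(\Phi_2)_{X,Y}=(\Phi_2)_{Y,X}\circ\sigma_{\Phi(Y),\Phi(X)}$. A *$\mathbb Z_2$-braided pair* $(\mathcal A,\mathcal M)$ consists of a braided monoidal category $\mathcal A$ with a braided anti-involution, a right $\mathcal A$-module category $\mathcal M$ (with action functor $\mathrm{act}\colon\mathcal M\times\mathcal A\to\mathcal M$, $(M,X)\mapsto M\otimes X$, and constraints $a_{M,X,Y}\colon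 M\otimes(X\otimes Y)\cong(M\otimes X)\otimes Y$, $r_M\colon M\otimes\mathbf 1\cong M$) with a distinguished object $\mathbf 1_{\mathcal M}$, and isomorphisms $\kappa_{M,X}\colon M\otimes X\to M\otimes\Phi(X)$, natural in $M\in\mathcal M$ and $X\in\mathcal A$, such that, suppressing $a$, $$\kappa_{M\otimes X,Y}=(\mathrm{id}_M\otimes\sigma_{\Phi(Y),X})\circ(\kappa_{M,Y}\otimes\mathrm{id}_X)\circ(\mathrm{id}_M\otimes\sigma_{X,Y}),$$ $$\kappa_{M,X\otimes Y}=(\mathrm{id}_M\otimes(\Phi_2)_{X,Y})\circ(\kappa_{M,Y}\otimes\mathrm{id}_{\Phi(X)})\circ(\mathrm{id}_M\otimes\sigma_{\Phi(X),Y})\circ(\kappa_{M,X}\otimes\mathrm{id}_Y).$$ It is a *$\mathbb Z_2$-symmetric pair* if $\sigma_{Y,X}\circ\sigma_{X,Y}=\mathrm{id}_{X\otimes Y}$ and $(\mathrm{id}_M\otimes t_X)\circ\kappa_{M,\Phi(X)}\circ\kappa_{M,X}=\mathrm{id}_{M\otimes X}$ for all $X,Y\in\mathcal A$ and $M\in\mathcal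 M$. For $n\ge 0$, an *$\mathcal A$-expression* is a formal expression in variables $x_1,\dots,x_n$, each occurring exactly once, built with the symbols $\mathbf 1$, $\otimes$ and $\Phi$. An *$\mathcal M$-expression* is a formal expression in a variable $m$ of $\mathcal M$ and $x_1,\dots,x_n$, each occurring exactly once, of the form $(\cdots(m\otimes U_1)\otimes\cdots)\otimes U_k$, $k\ge 0$, where each $U_j$ is built from the $x_i$ with $\mathbf 1$, $\otimes$ and $\Phi$. They denote functors $\mathcal A^{\times n}\to\mathcal A$ and $\mathcal M\times\mathcal A^{\times n}\to\mathcal M$ respectively. A *structural isomorphism* in $\mathcal A$ from an expression $T_1$ to an expression $T_2$ is a natural isomorphism between the functors that they denote which is obtained, compatibly with the formal expressions, by vertical and horizontal composition from $\mathrm{id}_{\mathrm{id}_{\mathcal A}},\mathrm{id}_{\mathbf 1},\mathrm{id}_\Phi,\mathrm{id}_\otimes,\alpha,\lambda,\rho,\sigma,\Phi_2,\Phi_0,t$ and their inverses; in $\mathcal M$ one uses in addition $\mathrm{id}_{\mathrm{id}_{\mathcal M}},\mathrm{id}_{\mathrm{act}},a,r,\kappa$ and their inverses. Two structural isomorphisms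 are *parallel* if they have the same source expression and the same target expression. **Theorem.** Let $(\mathcal A,\mathcal M)$ be a $\mathbb Z_2$-symmetric pair. Then any two parallel structural isomorphisms in $\mathcal A$ are equal, and any two parallel structural isomorphisms in $\mathcal M$ are equal. -/

import Mathlib

open CategoryTheory MonoidalCategory
open scoped MonoidalRightAction

universe v₁ v₂ u₁ u₂

/-- An anti-involution of a monoidal category `A`: a (strong) monoidal functor `Φ` from `A` to
`A` with the reversed tensor product, together with a monoidal natural isomorphism
`t : Φ² ≅ 𝟭` such that `Φ(t_X) = t_{Φ X}`. -/
structure AntiInvolution (A : Type u₁) [Category.{v₁} A] [MonoidalCategory A] where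
  /-- the underlying functor -/
  Φ : A ⥤ A
  /-- the tensor constraint `Φ₂`; the tensor product on the source is `Φ X ⊗ᵒᵖ Φ Y` -/
  Φ₂ : ∀ X Y : A, Φ.obj Y ⊗ Φ.obj X ≅ Φ.obj (X ⊗ Y)
  /-- the unit constraint -/
  Φ₀ : Φ.obj (𝟙_ A) ≅ 𝟙_ A
  Φ₂_natural : ∀ {X X' Y Y' : A} (f : X ⟶ X') (g : Y ⟶ Y'),
    (Φ.map g ⊗ₘ Φ.map f) ≫ (Φ₂ X' Y').hom = (Φ₂ X Y).hom ≫ Φ.map (f ⊗ₘ g)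
  Φ₂_associativity : ∀ X Y Z : A,
    (Φ.obj Z ◁ (Φ₂ X Y).hom) ≫ (Φ₂ (X ⊗ Y) Z).hom ≫ Φ.map (α_ X Y Z).hom =
      (α_ (Φ.obj Z) (Φ.obj Y) (Φ.obj X)).inv ≫ ((Φ₂ Y Z).hom ▷ Φ.obj X) ≫
        (Φ₂ X (Y ⊗ Z)).hom
  Φ₂_left_unit : ∀ X : A,
    (Φ₂ (𝟙_ A) X).hom ≫ Φ.map (λ_ X).hom = (Φ.obj X ◁ Φ₀.hom) ≫ (ρ_ (Φ.obj X)).hom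
  Φ₂_right_unit : ∀ X : A,
    (Φ₂ X (𝟙_ A)).hom ≫ Φ.map (ρ_ X).hom = (Φ₀.hom ▷ Φ.obj X) ≫ (λ_ (Φ.obj X)).hom
  /-- the natural isomorphism `Φ² ≅ 𝟭` -/
  t : Φ ⋙ Φ ≅ 𝟭 A
  /-- `t` is compatible with the tensor constraints of `Φ²` and of the identity -/
  t_tensor : ∀ X Y : A,
    (Φ₂ (Φ.obj Y) (Φ.obj X)).hom ≫ Φ.map (Φ₂ X Y).hom ≫ t.hom.app (X ⊗ Y) =
      (t.hom.app X ⊗ₘ t.hom.app Y)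
  /-- `t` is compatible with the unit constraints of `Φ²` and of the identity -/
  t_unit : t.hom.app (𝟙_ A) = Φ.map Φ₀.hom ≫ Φ₀.hom
  Φ_map_t : ∀ X : A, Φ.map (t.hom.app X) = t.hom.app (Φ.obj X)

/-- A `ℤ₂`-monoidal pair: a monoidal category `A` with an anti-involution, and a right
`A`-module category `M` with a distinguished object. -/
structure Z2MonoidalPair (A : Type u₁) [Category.{v₁} A] [MonoidalCategory A]
    (M : Type u₂) [Category.{v₂} M] [MonoidalRightAction A M] extends AntiInvolution A where
  /-- the distinguished object of the module category -/
  pt : M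

/-- A `ℤ₂`-braided pair: a `ℤ₂`-monoidal pair with `A` braided, `Φ` braided (with respect to the
braiding `β_ Y X : X ⊗ᵒᵖ Y ≅ Y ⊗ᵒᵖ X` of the reversed tensor product), and a `ℤ₂`-cylinder
braiding `κ`. Mathlib's associativity constraint of a right action is
`αᵣ m x y : m ⊙ᵣ (x ⊗ y) ≅ (m ⊙ᵣ x) ⊙ᵣ y`. -/
structure Z2BraidedPair (A : Type u₁) [Category.{v₁} A] [MonoidalCategory A] [BraidedCategory A]
    (M : Type u₂) [Category.{v₂} M] [MonoidalRightAction A M] extends Z2MonoidalPair A M where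
  Φ_braided : ∀ X Y : A,
    (Φ₂ X Y).hom ≫ Φ.map (β_ X Y).hom = (β_ (Φ.obj Y) (Φ.obj X)).hom ≫ (Φ₂ Y X).hom
  /-- the `ℤ₂`-cylinder braiding -/
  κ : ∀ (m : M) (X : A), m ⊙ᵣ X ≅ m ⊙ᵣ Φ.obj X
  κ_natural : ∀ {m m' : M} {X X' : A} (f : m ⟶ m') (g : X ⟶ X'),
    (f ⊙ᵣₘ g) ≫ (κ m' X').hom = (κ m X).hom ≫ (f ⊙ᵣₘ Φ.map g)
  /-- axiom BP1 -/
  κ_act : ∀ (m : M) (X Y : A),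
    (κ (m ⊙ᵣ X) Y).hom =
      (αᵣ m X Y).inv ≫ (m ⊴ᵣ (β_ X Y).hom) ≫ (αᵣ m Y X).hom ≫ ((κ m Y).hom ⊵ᵣ X) ≫
        (αᵣ m (Φ.obj Y) X).inv ≫ (m ⊴ᵣ (β_ (Φ.obj Y) X).hom) ≫ (αᵣ m X (Φ.obj Y)).hom
  /-- axiom BP2 -/
  κ_tensor : ∀ (m : M) (X Y : A),
    (κ m (X ⊗ Y)).hom =
      (αᵣ m X Y).hom ≫ ((κ m X).hom ⊵ᵣ Y) ≫ (αᵣ m (Φ.obj X) Y).inv ≫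
        (m ⊴ᵣ (β_ (Φ.obj X) Y).hom) ≫ (αᵣ m Y (Φ.obj X)).hom ≫
        ((κ m Y).hom ⊵ᵣ Φ.obj X) ≫ (αᵣ m (Φ.obj Y) (Φ.obj X)).inv ≫ (m ⊴ᵣ (Φ₂ X Y).hom)

/-- A `ℤ₂`-symmetric pair: a `ℤ₂`-braided pair with `σ² = id` and `κ² = id`, where in the latter
`m ⊙ᵣ Φ² X` is identified with `m ⊙ᵣ X` through `t`. -/
structure Z2SymmetricPair (A : Type u₁) [Category.{v₁} A] [MonoidalCategory A]
    [BraidedCategory A] (M : Type u₂) [Category.{v₂} M] [MonoidalRightAction A M]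
    extends Z2BraidedPair A M where
  σ_sq : ∀ X Y : A, (β_ X Y).hom ≫ (β_ Y X).hom = 𝟙 (X ⊗ Y)
  κ_sq : ∀ (m : M) (X : A),
    (κ m X).hom ≫ (κ m (Φ.obj X)).hom ≫ (m ⊴ᵣ t.hom.app X) = 𝟙 (m ⊙ᵣ X)

/-- Formal expressions for functors `Aⁿ ⥤ A` built from variables, the unit object, `⊗`
and `Φ`. -/
inductive AWord (n : ℕ) : Type
  | var (i : Fin n) : AWord n
  | unit : AWord n
  | tensor (U V : AWord n) : AWord n
  | phi (U : AWord n) : AWord n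

/-- Formal expressions for functors `M × Aⁿ ⥤ M` built from the variable of `M` by acting with
formal expressions for functors `Aⁿ ⥤ A`. -/
inductive MWord (n : ℕ) : Type
  | base : MWord n
  | act (P : MWord n) (U : AWord n) : MWord n

/-- The list of occurrences of variables in an expression. -/
def AWord.vars {n : ℕ} : AWord n → List (Fin n)
  | .var i => [i]
  | .unit => []
  | .tensor U V => U.vars ++ V.vars
  | .phi U => U.vars

/-- The list of occurrences of variables of `A` in an expression (the variable of `M` always
occurs exactly once). -/
def MWord.vars {n : ℕ} : MWord n → List (Fin n)
  | .base => []
  | .act P U => P.vars ++ U.vars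

/-- Every one of the `n` variables occurs exactly once, so that the functor is a composite of
products of the basic functors and permutations of the factors of `Aⁿ`. -/
def AWord.IsLinear {n : ℕ} (U : AWord n) : Prop := ∀ i : Fin n, U.vars.count i = 1

/-- Every one of the `n` variables of `A` occurs exactly once. -/
def MWord.IsLinear {n : ℕ} (P : MWord n) : Prop := ∀ i : Fin n, P.vars.count i = 1

namespace Z2BraidedPair

variable {A : Type u₁} [Category.{v₁} A] [MonoidalCategory A] [BraidedCategory A]
  {M : Type u₂} [Category.{v₂} M] [MonoidalRightAction A M]

variable (A M) in
/-- The action functor `act : M × A ⥤ M`. -/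
def actFunctor : M × A ⥤ M where
  obj x := x.1 ⊙ᵣ x.2
  map f := f.1 ⊙ᵣₘ f.2
  map_comp f g := MonoidalRightAction.actionHom_comp f.1 g.1 f.2 g.2

/-- The functor `Aⁿ ⥤ A` denoted by a formal expression. -/
def evalA (𝓟 : Z2BraidedPair A M) {n : ℕ} : AWord n → ((Fin n → A) ⥤ A)
  | .var i => Pi.eval (fun _ : Fin n => A) i
  | .unit => (Functor.const (Fin n → A)).obj (𝟙_ A)
  | .tensor U V => (𝓟.evalA U).prod' (𝓟.evalA V) ⋙ MonoidalCategory.tensor A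
  | .phi U => 𝓟.evalA U ⋙ 𝓟.Φ

/-- The functor `M × Aⁿ ⥤ M` denoted by a formal expression. -/
def evalM (𝓟 : Z2BraidedPair A M) {n : ℕ} : MWord n → (M × (Fin n → A) ⥤ M)
  | .base => CategoryTheory.Prod.fst M (Fin n → A)
  | .act P U =>
    (𝓟.evalM P).prod' (CategoryTheory.Prod.snd M (Fin n → A) ⋙ 𝓟.evalA U) ⋙ actFunctor A M

variable (𝓟 : Z2BraidedPair A M) {n : ℕ}

/-! ### The constituents of structural isomorphisms in `A` -/

/-- The horizontal composite `id_⊗ * (f, g)`. -/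
def tensorIso {U U' V V' : AWord n} (f : 𝓟.evalA U ≅ 𝓟.evalA U') (g : 𝓟.evalA V ≅ 𝓟.evalA V') :
    𝓟.evalA (.tensor U V) ≅ 𝓟.evalA (.tensor U' V') :=
  NatIso.ofComponents (fun x => f.app x ⊗ᵢ g.app x) (by
    intro x y h
    simp [evalA])

/-- The horizontal composite `id_Φ * f`. -/
def phiIso {U U' : AWord n} (f : 𝓟.evalA U ≅ 𝓟.evalA U') :
    𝓟.evalA (.phi U) ≅ 𝓟.evalA (.phi U') :=
  Functor.isoWhiskerRight f 𝓟.Φ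

/-- The associator `α` at `U`, `V`, `W`. -/
def alphaIso (U V W : AWord n) :
    𝓟.evalA (.tensor (.tensor U V) W) ≅ 𝓟.evalA (.tensor U (.tensor V W)) :=
  NatIso.ofComponents
    (fun x => α_ ((𝓟.evalA U).obj x) ((𝓟.evalA V).obj x) ((𝓟.evalA W).obj x)) (by
    intro x y h
    simp [evalA])

/-- The left unitor `λ` at `U`. -/
def lambdaIso (U : AWord n) : 𝓟.evalA (.tensor .unit U) ≅ 𝓟.evalA U :=
  NatIso.ofComponents (fun x => λ_ ((𝓟.evalA U).obj x)) (by
    intro x y h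
    simp [evalA])

/-- The right unitor `ρ` at `U`. -/
def rhoIso (U : AWord n) : 𝓟.evalA (.tensor U .unit) ≅ 𝓟.evalA U :=
  NatIso.ofComponents (fun x => ρ_ ((𝓟.evalA U).obj x)) (by
    intro x y h
    simp [evalA])

/-- The braiding `σ` at `U`, `V`. -/
def sigmaIso (U V : AWord n) : 𝓟.evalA (.tensor U V) ≅ 𝓟.evalA (.tensor V U) :=
  NatIso.ofComponents (fun x => β_ ((𝓟.evalA U).obj x) ((𝓟.evalA V).obj x)) (by
    intro x y h
    simp [evalA])

/-- The tensor constraint `Φ₂` at `U`, `V`. -/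
def phiTwoIso (U V : AWord n) :
    𝓟.evalA (.tensor (.phi V) (.phi U)) ≅ 𝓟.evalA (.phi (.tensor U V)) :=
  NatIso.ofComponents (fun x => 𝓟.Φ₂ ((𝓟.evalA U).obj x) ((𝓟.evalA V).obj x)) (by
    intro x y h
    exact 𝓟.Φ₂_natural ((𝓟.evalA U).map h) ((𝓟.evalA V).map h))

/-- The unit constraint `Φ₀`, a natural isomorphism of constant functors. -/
def phiZeroIso : 𝓟.evalA (n := n) (.phi .unit) ≅ 𝓟.evalA (.unit) :=
  NatIso.ofComponents (fun _ => 𝓟.Φ₀) (by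
    intro x y h
    simp [evalA])

/-- The isomorphism `t : Φ² ≅ 𝟭` at `U`. -/
def tIso (U : AWord n) : 𝓟.evalA (.phi (.phi U)) ≅ 𝓟.evalA U :=
  NatIso.ofComponents (fun x => 𝓟.t.app ((𝓟.evalA U).obj x)) (by
    intro x y h
    exact 𝓟.t.hom.naturality ((𝓟.evalA U).map h))

/-- Structural isomorphisms in `A`: the natural isomorphisms between functors `Aⁿ ⥤ A` that are
vertical and horizontal composites of identities, `α`, `λ`, `ρ`, `σ`, `Φ₂`, `Φ₀`, `t` and
inverses of these. By the interchange law it suffices to allow the basic isomorphisms at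
arbitrary expressions, horizontal composites with `id_⊗` and `id_Φ`, vertical composites and
inverses. -/
inductive IsStructuralA : ∀ {U V : AWord n}, (𝓟.evalA U ≅ 𝓟.evalA V) → Prop
  | refl (U : AWord n) : IsStructuralA (Iso.refl (𝓟.evalA U))
  | symm {U V : AWord n} {f : 𝓟.evalA U ≅ 𝓟.evalA V} :
      IsStructuralA f → IsStructuralA f.symm
  | trans {U V W : AWord n} {f : 𝓟.evalA U ≅ 𝓟.evalA V} {g : 𝓟.evalA V ≅ 𝓟.evalA W} :
      IsStructuralA f → IsStructuralA g → IsStructuralA (f ≪≫ g)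
  | tensor {U U' V V' : AWord n} {f : 𝓟.evalA U ≅ 𝓟.evalA U'} {g : 𝓟.evalA V ≅ 𝓟.evalA V'} :
      IsStructuralA f → IsStructuralA g → IsStructuralA (𝓟.tensorIso f g)
  | phi {U U' : AWord n} {f : 𝓟.evalA U ≅ 𝓟.evalA U'} :
      IsStructuralA f → IsStructuralA (𝓟.phiIso f)
  | alpha (U V W : AWord n) : IsStructuralA (𝓟.alphaIso U V W)
  | lambda (U : AWord n) : IsStructuralA (𝓟.lambdaIso U)
  | rho (U : AWord n) : IsStructuralA (𝓟.rhoIso U)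
  | sigma (U V : AWord n) : IsStructuralA (𝓟.sigmaIso U V)
  | phiTwo (U V : AWord n) : IsStructuralA (𝓟.phiTwoIso U V)
  | phiZero : IsStructuralA 𝓟.phiZeroIso
  | t (U : AWord n) : IsStructuralA (𝓟.tIso U)

/-! ### The constituents of structural isomorphisms in `M` -/

/-- The horizontal composite `id_act * (f, g)`. -/
def actIso {P P' : MWord n} {U U' : AWord n} (f : 𝓟.evalM P ≅ 𝓟.evalM P')
    (g : 𝓟.evalA U ≅ 𝓟.evalA U') : 𝓟.evalM (.act P U) ≅ 𝓟.evalM (.act P' U') :=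
  NatIso.ofComponents (fun x => (actFunctor A M).mapIso (Iso.prod (f.app x) (g.app x.2))) (by
    intro x y h
    have hf := f.hom.naturality h
    have hg := g.hom.naturality h.2
    change ((𝓟.evalM P).map h ⊙ᵣₘ (𝓟.evalA U).map h.2) ≫ (f.hom.app y ⊙ᵣₘ g.hom.app y.2) =
      (f.hom.app x ⊙ᵣₘ g.hom.app x.2) ≫ ((𝓟.evalM P').map h ⊙ᵣₘ (𝓟.evalA U').map h.2)
    rw [← MonoidalRightAction.actionHom_comp, ← MonoidalRightAction.actionHom_comp, hf, hg])

/-- The module associator `a` at `P`, `U`, `V`. -/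
def aIso (P : MWord n) (U V : AWord n) :
    𝓟.evalM (.act P (.tensor U V)) ≅ 𝓟.evalM (.act (.act P U) V) :=
  NatIso.ofComponents
    (fun x => αᵣ ((𝓟.evalM P).obj x) ((𝓟.evalA U).obj x.2) ((𝓟.evalA V).obj x.2)) (by
    intro x y h
    exact MonoidalRightAction.actionAssocIso_hom_naturality
      ((𝓟.evalM P).map h) ((𝓟.evalA U).map h.2) ((𝓟.evalA V).map h.2))

/-- The module unitor `r` at `P`. -/
def rIso (P : MWord n) : 𝓟.evalM (.act P .unit) ≅ 𝓟.evalM P :=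
  NatIso.ofComponents (fun x => ρᵣ[A] ((𝓟.evalM P).obj x)) (by
    intro x y h
    change ((𝓟.evalM P).map h ⊙ᵣₘ 𝟙 (𝟙_ A)) ≫ _ = _
    rw [MonoidalRightAction.actionHom_id]
    exact (MonoidalRightAction.actionUnitIso_hom_naturality ((𝓟.evalM P).map h)).symm)

/-- The `ℤ₂`-cylinder braiding `κ` at `P`, `U`. -/
def kappaIso (P : MWord n) (U : AWord n) :
    𝓟.evalM (.act P U) ≅ 𝓟.evalM (.act P (.phi U)) :=
  NatIso.ofComponents (fun x => 𝓟.κ ((𝓟.evalM P).obj x) ((𝓟.evalA U).obj x.2)) (by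
    intro x y h
    exact 𝓟.κ_natural ((𝓟.evalM P).map h) ((𝓟.evalA U).map h.2))

/-- Structural isomorphisms in `M`: the natural isomorphisms between functors `M × Aⁿ ⥤ M` that
are vertical and horizontal composites of identities, `a`, `r`, `κ`, the basic isomorphisms in
`A`, and inverses of these. -/
inductive IsStructuralM : ∀ {P Q : MWord n}, (𝓟.evalM P ≅ 𝓟.evalM Q) → Prop
  | refl (P : MWord n) : IsStructuralM (Iso.refl (𝓟.evalM P))
  | symm {P Q : MWord n} {f : 𝓟.evalM P ≅ 𝓟.evalM Q} :
      IsStructuralM f → IsStructuralM f.symm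
  | trans {P Q R : MWord n} {f : 𝓟.evalM P ≅ 𝓟.evalM Q} {g : 𝓟.evalM Q ≅ 𝓟.evalM R} :
      IsStructuralM f → IsStructuralM g → IsStructuralM (f ≪≫ g)
  | act {P P' : MWord n} {U U' : AWord n} {f : 𝓟.evalM P ≅ 𝓟.evalM P'}
      {g : 𝓟.evalA U ≅ 𝓟.evalA U'} :
      IsStructuralM f → 𝓟.IsStructuralA g → IsStructuralM (𝓟.actIso f g)
  | a (P : MWord n) (U V : AWord n) : IsStructuralM (𝓟.aIso P U V)
  | r (P : MWord n) : IsStructuralM (𝓟.rIso P)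
  | kappa (P : MWord n) (U : AWord n) : IsStructuralM (𝓟.kappaIso P U)

end Z2BraidedPair

/-! In a symmetric category, composing `Φ₂` with the braiding makes `Φ` a braided monoidal functor.
Every expression then denotes a strong monoidal functor on `Aⁿ`, and every structural isomorphism in
`A` is a monoidal transformation (`IsStructuralA.tensor_comp_evalTensor`), so its value at `y ⊗ z`
is determined by its values at `y` and `z`. Every tuple is, up to unitors, a tensor product of
tuples that are `𝟙_ A` outside one slot. On such a tuple a linear expression reduces to `X` or `Φ X`
(to `𝟙_ A` if no slot is filled), and structural isomorphisms commute with the reductions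
(`IsStructuralA.agree`). This forces parallel ones to coincide.

In `M`, the axioms of `κ` and the symmetry of `σ` make `κ` a natural isomorphism between the actions
of `X` and `Φ X` that commutes with the actions of other objects. It serves to delete every `Φ`,
after which all acting objects are collected into one object of `A`. Conjugation by this reduction
turns a structural isomorphism in `M` into the action of one in `A`
(`IsStructuralM.exists_flatten`), where coherence is already known. -/

theorem CategoryTheory.MonoidalCategory.inv_tensorHom_inv_comp {C : Type u₁} [Category.{v₁} C]
    [MonoidalCategory C] {U U₁ U₂ U' U₁' U₂' : C} {m : U₁ ⊗ U₂ ⟶ U}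
    {m' : U₁' ⊗ U₂' ⟶ U'}
    (f₁ : U₁ ≅ U₁') (f₂ : U₂ ≅ U₂') (f : U ≅ U')
    (hf : (f₁.hom ⊗ₘ f₂.hom) ≫ m' = m ≫ f.hom) :
    (f₁.inv ⊗ₘ f₂.inv) ≫ m = m' ≫ f.inv := by
  rw [← cancel_epi (f₁.hom ⊗ₘ f₂.hom), reassoc_of% hf, tensorHom_comp_tensorHom_assoc]
  simp

/-! ### Monoidality of the constraints of a symmetric category -/

namespace CategoryTheory.SymmetricCategory

variable {C : Type u₁} [Category.{v₁} C] [MonoidalCategory C] [SymmetricCategory C]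

/-- The braiding of a symmetric monoidal category is a monoidal natural transformation. -/
theorem tensorμ_braiding (X₁ X₂ Y₁ Y₂ : C) :
    tensorμ X₁ X₂ Y₁ Y₂ ≫ (β_ (X₁ ⊗ Y₁) (X₂ ⊗ Y₂)).hom =
      ((β_ X₁ X₂).hom ⊗ₘ (β_ Y₁ Y₂).hom) ≫ tensorμ X₂ X₁ Y₂ Y₁ := by
  dsimp only [tensorμ]
  simp only [BraidedCategory.braiding_tensor_left_hom, BraidedCategory.braiding_tensor_right_hom]
  -- The swap inside `tensorμ` and one of the four swaps of the block braiding form a double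
  -- braiding of `X₂` and `Y₁`, which symmetry removes.
  calc
    _ = 𝟙 _ ⊗≫ X₁ ◁ ((β_ X₂ Y₁).hom ≫ (β_ Y₁ X₂).hom) ▷ Y₂ ⊗≫
        ((β_ X₁ X₂).hom ▷ (Y₁ ⊗ Y₂) ≫ (X₂ ⊗ X₁) ◁ (β_ Y₁ Y₂).hom) ⊗≫
        X₂ ◁ (β_ X₁ Y₂).hom ▷ Y₁ ⊗≫ 𝟙 _ := by monoidal
    _ = _ := by rw [symmetry, MonoidalCategory.tensorHom_def]; monoidal

section

variable {U V W U₁ V₁ W₁ U₂ V₂ W₂ : C}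

/-- Here and below, `m`, `k`, `l` stand for the tensor constraints of the functors denoted by
subexpressions, so that each lemma is one case of the induction on structural isomorphisms. -/
theorem tensorμ_comp_tensorHom_natural {U' U₁' U₂' V' V₁' V₂' : C} {m : U₁ ⊗ U₂ ⟶ U}
    {m' : U₁' ⊗ U₂' ⟶ U'} {k : V₁ ⊗ V₂ ⟶ V} {k' : V₁' ⊗ V₂' ⟶ V'} {f₁ : U₁ ⟶ U₁'}
    {f₂ : U₂ ⟶ U₂'} {f : U ⟶ U'} {g₁ : V₁ ⟶ V₁'} {g₂ : V₂ ⟶ V₂'} {g : V ⟶ V'}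
    (hf : (f₁ ⊗ₘ f₂) ≫ m' = m ≫ f) (hg : (g₁ ⊗ₘ g₂) ≫ k' = k ≫ g) :
    ((f₁ ⊗ₘ g₁) ⊗ₘ (f₂ ⊗ₘ g₂)) ≫ tensorμ U₁' V₁' U₂' V₂' ≫ (m' ⊗ₘ k') =
      (tensorμ U₁ V₁ U₂ V₂ ≫ (m ⊗ₘ k)) ≫ (f ⊗ₘ g) := by
  simp only [tensorμ_natural_assoc, Category.assoc, tensorHom_comp_tensorHom, hf, hg]

theorem associator_comp_tensorμ (m : U₁ ⊗ U₂ ⟶ U) (k : V₁ ⊗ V₂ ⟶ V) (l : W₁ ⊗ W₂ ⟶ W) :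
    ((α_ U₁ V₁ W₁).hom ⊗ₘ (α_ U₂ V₂ W₂).hom) ≫ tensorμ U₁ (V₁ ⊗ W₁) U₂ (V₂ ⊗ W₂) ≫
        (m ⊗ₘ (tensorμ V₁ W₁ V₂ W₂ ≫ (k ⊗ₘ l))) =
      (tensorμ (U₁ ⊗ V₁) W₁ (U₂ ⊗ V₂) W₂ ≫ ((tensorμ U₁ V₁ U₂ V₂ ≫ (m ⊗ₘ k)) ⊗ₘ l)) ≫
        (α_ U V W).hom := by
  have h₁ : (m ⊗ₘ (tensorμ V₁ W₁ V₂ W₂ ≫ (k ⊗ₘ l))) =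
      (_ ◁ tensorμ V₁ W₁ V₂ W₂) ≫ (m ⊗ₘ (k ⊗ₘ l)) := by simp [MonoidalCategory.tensorHom_def']
  have h₂ : ((tensorμ U₁ V₁ U₂ V₂ ≫ (m ⊗ₘ k)) ⊗ₘ l) =
      (tensorμ U₁ V₁ U₂ V₂ ▷ _) ≫ ((m ⊗ₘ k) ⊗ₘ l) := by simp [MonoidalCategory.tensorHom_def]
  rw [h₁, h₂, Category.assoc, Category.assoc, associator_naturality, associator_monoidal_assoc]

theorem leftUnitor_comp_tensorμ (m : U₁ ⊗ U₂ ⟶ U) :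
    ((λ_ U₁).hom ⊗ₘ (λ_ U₂).hom) ≫ m =
      (tensorμ (𝟙_ C) U₁ (𝟙_ C) U₂ ≫ ((λ_ (𝟙_ C)).hom ⊗ₘ m)) ≫ (λ_ U).hom := by
  rw [leftUnitor_monoidal]
  simp only [Category.assoc, MonoidalCategory.tensorHom_def, leftUnitor_naturality]

theorem rightUnitor_comp_tensorμ (m : U₁ ⊗ U₂ ⟶ U) :
    ((ρ_ U₁).hom ⊗ₘ (ρ_ U₂).hom) ≫ m =
      (tensorμ U₁ (𝟙_ C) U₂ (𝟙_ C) ≫ (m ⊗ₘ (λ_ (𝟙_ C)).hom)) ≫ (ρ_ U).hom := by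
  rw [rightUnitor_monoidal]
  simp only [Category.assoc, MonoidalCategory.tensorHom_def', rightUnitor_naturality]

theorem braiding_comp_tensorμ (m : U₁ ⊗ U₂ ⟶ U) (k : V₁ ⊗ V₂ ⟶ V) :
    ((β_ U₁ V₁).hom ⊗ₘ (β_ U₂ V₂).hom) ≫ tensorμ V₁ U₁ V₂ U₂ ≫ (k ⊗ₘ m) =
      (tensorμ U₁ V₁ U₂ V₂ ≫ (m ⊗ₘ k)) ≫ (β_ U V).hom := by
  rw [Category.assoc, BraidedCategory.braiding_naturality, reassoc_of% @tensorμ_braiding]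

end

end CategoryTheory.SymmetricCategory

/-! ### The anti-involution as a braided monoidal functor -/

namespace AntiInvolution

variable {A : Type u₁} [Category.{v₁} A] [MonoidalCategory A] [SymmetricCategory A]

/-- The tensor constraint of `Φ` precomposed with the braiding. -/
def mu (𝓘 : AntiInvolution A) (X Y : A) : 𝓘.Φ.obj X ⊗ 𝓘.Φ.obj Y ≅ 𝓘.Φ.obj (X ⊗ Y) :=
  β_ (𝓘.Φ.obj X) (𝓘.Φ.obj Y) ≪≫ 𝓘.Φ₂ X Y

theorem mu_natural (𝓘 : AntiInvolution A) {X X' Y Y' : A} (f : X ⟶ X') (g : Y ⟶ Y') :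
    (𝓘.Φ.map f ⊗ₘ 𝓘.Φ.map g) ≫ (𝓘.mu X' Y').hom = (𝓘.mu X Y).hom ≫ 𝓘.Φ.map (f ⊗ₘ g) := by
  simp [mu, ← 𝓘.Φ₂_natural]

/-- A braided anti-involution of a symmetric monoidal category is a braided functor. -/
abbrev laxBraided (𝓘 : AntiInvolution A)
    (h : ∀ X Y : A, (𝓘.Φ₂ X Y).hom ≫ 𝓘.Φ.map (β_ X Y).hom =
      (β_ (𝓘.Φ.obj Y) (𝓘.Φ.obj X)).hom ≫ (𝓘.Φ₂ Y X).hom) : 𝓘.Φ.LaxBraided where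
  ε := 𝓘.Φ₀.inv
  μ X Y := (𝓘.mu X Y).hom
  μ_natural_left f Z := by simpa using 𝓘.mu_natural f (𝟙 Z)
  μ_natural_right Z f := by simpa using 𝓘.mu_natural (𝟙 Z) f
  associativity X Y Z := by
    simp only [mu, Iso.trans_hom, comp_whiskerRight, Category.assoc,
      MonoidalCategory.whiskerLeft_comp, BraidedCategory.braiding_naturality_left_assoc,
      BraidedCategory.braiding_naturality_right_assoc, 𝓘.Φ₂_associativity]
    simp only [BraidedCategory.braiding_tensor_left_hom, BraidedCategory.braiding_tensor_right_hom,
      Category.assoc, Iso.hom_inv_id_assoc]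
    -- Both sides reverse three factors, by the two decompositions that Yang–Baxter identifies.
    rw [← BraidedCategory.yang_baxter_assoc]
    simp
  left_unitality X := by
    have := 𝓘.Φ₂_left_unit X
    simp [mu, this]
  right_unitality X := by
    have := 𝓘.Φ₂_right_unit X
    simp [mu, this]
  braided X Y := by simp [mu, h]

theorem mu_comp_map_natural (𝓘 : AntiInvolution A) {U U₁ U₂ U' U₁' U₂' : A} {m : U₁ ⊗ U₂ ⟶ U}
    {m' : U₁' ⊗ U₂' ⟶ U'} {f₁ : U₁ ⟶ U₁'} {f₂ : U₂ ⟶ U₂'} {f : U ⟶ U'}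
    (hf : (f₁ ⊗ₘ f₂) ≫ m' = m ≫ f) :
    (𝓘.Φ.map f₁ ⊗ₘ 𝓘.Φ.map f₂) ≫ (𝓘.mu U₁' U₂').hom ≫ 𝓘.Φ.map m' =
      ((𝓘.mu U₁ U₂).hom ≫ 𝓘.Φ.map m) ≫ 𝓘.Φ.map f := by
  rw [← Category.assoc, 𝓘.mu_natural, Category.assoc, Category.assoc, ← 𝓘.Φ.map_comp,
    ← 𝓘.Φ.map_comp, hf]

theorem Φ₂_eq (𝓘 : AntiInvolution A) (X Y : A) :
    (𝓘.Φ₂ X Y).hom = (β_ (𝓘.Φ.obj Y) (𝓘.Φ.obj X)).hom ≫ (𝓘.mu X Y).hom := by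
  simp [mu]

/-- `Φ₂` is a braiding followed by `mu`; the former is monoidal by symmetry, the latter because `Φ`
is a braided functor. -/
theorem Φ₂_comp_mu (𝓘 : AntiInvolution A)
    (h : ∀ X Y : A, (𝓘.Φ₂ X Y).hom ≫ 𝓘.Φ.map (β_ X Y).hom =
      (β_ (𝓘.Φ.obj Y) (𝓘.Φ.obj X)).hom ≫ (𝓘.Φ₂ Y X).hom)
    {U U₁ U₂ V V₁ V₂ : A} (m : U₁ ⊗ U₂ ⟶ U) (k : V₁ ⊗ V₂ ⟶ V) :
    ((𝓘.Φ₂ U₁ V₁).hom ⊗ₘ (𝓘.Φ₂ U₂ V₂).hom) ≫ (𝓘.mu (U₁ ⊗ V₁) (U₂ ⊗ V₂)).hom ≫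
        𝓘.Φ.map (tensorμ U₁ V₁ U₂ V₂ ≫ (m ⊗ₘ k)) =
      (tensorμ (𝓘.Φ.obj V₁) (𝓘.Φ.obj U₁) (𝓘.Φ.obj V₂) (𝓘.Φ.obj U₂) ≫
        (((𝓘.mu V₁ V₂).hom ≫ 𝓘.Φ.map k) ⊗ₘ ((𝓘.mu U₁ U₂).hom ≫ 𝓘.Φ.map m))) ≫
        (𝓘.Φ₂ U V).hom := by
  let _ := 𝓘.laxBraided h
  have key := tensorμ_comp_μ_tensorHom_μ_comp_μ 𝓘.Φ U₁ V₁ U₂ V₂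
  change tensorμ _ _ _ _ ≫ ((𝓘.mu U₁ U₂).hom ⊗ₘ (𝓘.mu V₁ V₂).hom) ≫ (𝓘.mu _ _).hom =
    ((𝓘.mu U₁ V₁).hom ⊗ₘ (𝓘.mu U₂ V₂).hom) ≫ (𝓘.mu _ _).hom ≫ _ at key
  simp only [𝓘.Φ₂_eq, Category.assoc, ← tensorHom_comp_tensorHom, 𝓘.Φ.map_comp,
    BraidedCategory.braiding_naturality_assoc, 𝓘.mu_natural,
    reassoc_of% @SymmetricCategory.tensorμ_braiding, reassoc_of% key]

theorem Φ₀_comp_leftUnitor (𝓘 : AntiInvolution A) :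
    (𝓘.Φ₀.hom ⊗ₘ 𝓘.Φ₀.hom) ≫ (λ_ (𝟙_ A)).hom =
      ((𝓘.mu (𝟙_ A) (𝟙_ A)).hom ≫ 𝓘.Φ.map (λ_ (𝟙_ A)).hom) ≫ 𝓘.Φ₀.hom := by
  have := 𝓘.Φ₂_left_unit (𝟙_ A)
  simp only [mu, Iso.trans_hom, Category.assoc, reassoc_of% this]
  rw [← BraidedCategory.braiding_naturality_left_assoc]
  simp [MonoidalCategory.tensorHom_def]

/-- The constraint of `Φ²` contains two braidings, one for each `Φ`. Braidedness of `Φ` brings them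
together, symmetry cancels them, and `t_tensor` remains. -/
theorem t_comp_mu (𝓘 : AntiInvolution A)
    (h : ∀ X Y : A, (𝓘.Φ₂ X Y).hom ≫ 𝓘.Φ.map (β_ X Y).hom =
      (β_ (𝓘.Φ.obj Y) (𝓘.Φ.obj X)).hom ≫ (𝓘.Φ₂ Y X).hom)
    {U U₁ U₂ : A} (m : U₁ ⊗ U₂ ⟶ U) :
    (𝓘.t.hom.app U₁ ⊗ₘ 𝓘.t.hom.app U₂) ≫ m =
      ((𝓘.mu (𝓘.Φ.obj U₁) (𝓘.Φ.obj U₂)).hom ≫ 𝓘.Φ.map ((𝓘.mu U₁ U₂).hom ≫ 𝓘.Φ.map m)) ≫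
        𝓘.t.hom.app U := by
  have ht : 𝓘.Φ.map (𝓘.Φ.map m) ≫ 𝓘.t.hom.app U = 𝓘.t.hom.app (U₁ ⊗ U₂) ≫ m :=
    𝓘.t.hom.naturality m
  simp only [mu, Iso.trans_hom, 𝓘.Φ.map_comp, Category.assoc, ht, reassoc_of% h,
    SymmetricCategory.symmetry_assoc]
  rw [← 𝓘.t_tensor]
  simp

end AntiInvolution

/-! ### Expressions as monoidal functors -/

namespace Z2BraidedPair

variable {A : Type u₁} [Category.{v₁} A] [MonoidalCategory A] [SymmetricCategory A]
  {M : Type u₂} [Category.{v₂} M] [MonoidalRightAction A M] (𝓟 : Z2BraidedPair A M) {n : ℕ}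

/-- The tensor constraint of the functor `Aⁿ ⥤ A` denoted by an expression. -/
def evalTensor (y z : Fin n → A) : ∀ U : AWord n,
    (𝓟.evalA U).obj y ⊗ (𝓟.evalA U).obj z ≅ (𝓟.evalA U).obj (fun j => y j ⊗ z j)
  | .var i => Iso.refl (y i ⊗ z i)
  | .unit => λ_ (𝟙_ A)
  | .tensor U V => (⟨tensorμ _ _ _ _, tensorδ _ _ _ _, tensorμ_tensorδ .., tensorδ_tensorμ ..⟩ :
      (((𝓟.evalA U).obj y ⊗ (𝓟.evalA V).obj y) ⊗ (𝓟.evalA U).obj z ⊗ (𝓟.evalA V).obj z) ≅ _) ≪≫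
      (evalTensor y z U ⊗ᵢ evalTensor y z V)
  | .phi U => 𝓟.mu ((𝓟.evalA U).obj y) ((𝓟.evalA U).obj z) ≪≫ 𝓟.Φ.mapIso (evalTensor y z U)

/-- A structural isomorphism is a monoidal natural transformation. -/
theorem IsStructuralA.tensor_comp_evalTensor {𝓟 : Z2BraidedPair A M} {U V : AWord n} {f : 𝓟.evalA U ≅ 𝓟.evalA V}
    (hf : 𝓟.IsStructuralA f) (y z : Fin n → A) :
    (f.hom.app y ⊗ₘ f.hom.app z) ≫ (𝓟.evalTensor y z V).hom =
      (𝓟.evalTensor y z U).hom ≫ f.hom.app (fun j => y j ⊗ z j) := by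
  induction hf with
  | refl U => simp
  | symm _ ih =>
    exact inv_tensorHom_inv_comp (Iso.app _ y) (Iso.app _ z) (Iso.app _ _) ih
  | trans _ _ ihf ihg =>
    simp [← tensorHom_comp_tensorHom, ihg, reassoc_of% ihf]
  | tensor _ _ ihf ihg => exact SymmetricCategory.tensorμ_comp_tensorHom_natural ihf ihg
  | phi _ ih => exact AntiInvolution.mu_comp_map_natural _ ih
  | alpha U V W => exact SymmetricCategory.associator_comp_tensorμ ..
  | lambda U => exact SymmetricCategory.leftUnitor_comp_tensorμ ..
  | rho U => exact SymmetricCategory.rightUnitor_comp_tensorμ ..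
  | sigma U V => exact SymmetricCategory.braiding_comp_tensorμ ..
  | phiTwo U V => exact 𝓟.Φ₂_comp_mu 𝓟.Φ_braided _ _
  | phiZero => exact 𝓟.Φ₀_comp_leftUnitor
  | t U => exact 𝓟.t_comp_mu 𝓟.Φ_braided _

end Z2BraidedPair

/-! ### Normal forms of expressions in one variable -/

theorem AWord.countP_tensor {n : ℕ} (p : Fin n → Bool) (U V : AWord n) :
    (AWord.tensor U V).vars.countP p = U.vars.countP p + V.vars.countP p :=
  List.countP_append

namespace AntiInvolution

variable {A : Type u₁} [Category.{v₁} A] [MonoidalCategory A] (𝓘 : AntiInvolution A)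

theorem Φ₂_comp_map_leftUnitor {Y Z : A} (p : 𝓘.Φ.obj Y ⟶ Z) :
    (𝓘.Φ₂ (𝟙_ A) Y).hom ≫ 𝓘.Φ.map (λ_ Y).hom ≫ p = (p ⊗ₘ 𝓘.Φ₀.hom) ≫ (ρ_ Z).hom := by
  rw [reassoc_of% 𝓘.Φ₂_left_unit Y]
  simp [MonoidalCategory.tensorHom_def']

theorem Φ₂_comp_map_rightUnitor {Y Z : A} (p : 𝓘.Φ.obj Y ⟶ Z) :
    (𝓘.Φ₂ Y (𝟙_ A)).hom ≫ 𝓘.Φ.map (ρ_ Y).hom ≫ p = (𝓘.Φ₀.hom ⊗ₘ p) ≫ (λ_ Z).hom := by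
  rw [reassoc_of% 𝓘.Φ₂_right_unit Y]
  simp [MonoidalCategory.tensorHom_def]

end AntiInvolution

/-- The normal form of an expression in a single variable: the unit, the variable, or its image
under `Φ`. All other expressions get the shape `other`. -/
inductive SlotShape (A : Type u₁) : Type u₁
  | empty : SlotShape A
  | var (b : Bool) : SlotShape A
  | other (Z : A) : SlotShape A

namespace SlotShape

variable {A : Type u₁}

/-- An upper bound for the number of occurrences of the variable that are detected. -/
def weight : SlotShape A → ℕ
  | empty => 0
  | var _ => 1
  | other _ => 2

variable [Category.{v₁} A] [MonoidalCategory A] (𝓘 : AntiInvolution A) (X : A)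

/-- The object denoted by a shape when the variable is `X`. -/
def obj : SlotShape A → A
  | empty => 𝟙_ A
  | var false => X
  | var true => 𝓘.Φ.obj X
  | other Z => Z

/-- The shape of a tensor product. -/
def tensor : SlotShape A → SlotShape A → SlotShape A
  | empty, t => t
  | var b, empty => var b
  | other Z, empty => other Z
  | var b, var c => other ((var b).obj 𝓘 X ⊗ (var c).obj 𝓘 X)
  | var b, other Z => other ((var b).obj 𝓘 X ⊗ Z)
  | other Z, var c => other (Z ⊗ (var c).obj 𝓘 X)
  | other Z, other W => other (Z ⊗ W)

/-- The shape of an image under `Φ`. -/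
def phi : SlotShape A → SlotShape A
  | empty => empty
  | var b => var !b
  | other Z => other (𝓘.Φ.obj Z)

/-- The reduction of a tensor product to its normal form. -/
def tensorObj : ∀ s t : SlotShape A, s.obj 𝓘 X ⊗ t.obj 𝓘 X ≅ (s.tensor 𝓘 X t).obj 𝓘 X
  | empty, t => λ_ (t.obj 𝓘 X)
  | var b, empty => ρ_ ((var b).obj 𝓘 X)
  | other Z, empty => ρ_ Z
  | var _, var _ => Iso.refl _
  | var _, other _ => Iso.refl _
  | other _, var _ => Iso.refl _
  | other _, other _ => Iso.refl _

/-- The reduction of an image under `Φ` to its normal form. -/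
def phiObj : ∀ s : SlotShape A, 𝓘.Φ.obj (s.obj 𝓘 X) ≅ (s.phi 𝓘).obj 𝓘 X
  | empty => 𝓘.Φ₀
  | var false => Iso.refl _
  | var true => 𝓘.t.app X
  | other _ => Iso.refl _

/-- With this bound, at most one occurrence of the variable rules out `other`. Equality fails
because weights are capped at 2. -/
theorem weight_tensor (s t : SlotShape A) :
    (s.tensor 𝓘 X t).weight ≤ s.weight + t.weight := by
  cases s <;> cases t <;> simp [tensor, weight]

theorem weight_phi (s : SlotShape A) : (s.phi 𝓘).weight = s.weight := by
  cases s <;> rfl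

variable {X}

/-- Two morphisms to objects denoted by shapes agree after the shapes are identified. -/
def Agree {U : A} {s t : SlotShape A} (f : U ⟶ s.obj 𝓘 X) (g : U ⟶ t.obj 𝓘 X) : Prop :=
  ∃ h : s = t, f ≫ eqToHom (congrArg (obj 𝓘 X) h) = g

variable {𝓘}

theorem Agree.of_eq {U : A} {s : SlotShape A} {f g : U ⟶ s.obj 𝓘 X} (h : f = g) :
    Agree 𝓘 f g := ⟨rfl, by simp [h]⟩

theorem Agree.eq {U : A} {s : SlotShape A} {f g : U ⟶ s.obj 𝓘 X} (h : Agree 𝓘 f g) :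
    f = g := by
  obtain ⟨_, h⟩ := h
  simpa using h

theorem Agree.symm {U : A} {s t : SlotShape A} {f : U ⟶ s.obj 𝓘 X} {g : U ⟶ t.obj 𝓘 X}
    (h : Agree 𝓘 f g) : Agree 𝓘 g f := by
  obtain ⟨rfl, h⟩ := h
  exact of_eq (by simpa using h.symm)

theorem Agree.trans {U : A} {r s t : SlotShape A} {f : U ⟶ r.obj 𝓘 X} {g : U ⟶ s.obj 𝓘 X}
    {k : U ⟶ t.obj 𝓘 X} (h : Agree 𝓘 f g) (h' : Agree 𝓘 g k) : Agree 𝓘 f k := by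
  obtain ⟨rfl, h⟩ := h
  obtain ⟨rfl, h'⟩ := h'
  exact of_eq (by simpa using (h.trans (by simpa using h')))

theorem Agree.precomp {U V : A} {s t : SlotShape A} {f : U ⟶ s.obj 𝓘 X} {g : U ⟶ t.obj 𝓘 X}
    (h : Agree 𝓘 f g) (k : V ⟶ U) : Agree 𝓘 (k ≫ f) (k ≫ g) := by
  obtain ⟨rfl, h⟩ := h
  exact of_eq (by simp at h; rw [h])

theorem Agree.tensor {U U' V V' : A} {s s' t t' : SlotShape A} {a : U ⟶ s.obj 𝓘 X}
    {a' : U' ⟶ s'.obj 𝓘 X} {b : V ⟶ t.obj 𝓘 X} {b' : V' ⟶ t'.obj 𝓘 X} {f : U ⟶ U'} {g : V ⟶ V'}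
    (hf : Agree 𝓘 (f ≫ a') a) (hg : Agree 𝓘 (g ≫ b') b) :
    Agree 𝓘 ((f ⊗ₘ g) ≫ (a' ⊗ₘ b') ≫ (tensorObj 𝓘 X s' t').hom)
      ((a ⊗ₘ b) ≫ (tensorObj 𝓘 X s t).hom) := by
  -- `id` makes a copy, so that `hf` survives the identification of the shapes.
  obtain ⟨rfl, _⟩ := id hf
  obtain ⟨rfl, _⟩ := id hg
  exact of_eq (by rw [tensorHom_comp_tensorHom_assoc, hf.eq, hg.eq])

theorem Agree.phi {U U' : A} {s s' : SlotShape A} {a : U ⟶ s.obj 𝓘 X} {a' : U' ⟶ s'.obj 𝓘 X}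
    {f : U ⟶ U'} (hf : Agree 𝓘 (f ≫ a') a) :
    Agree 𝓘 (𝓘.Φ.map f ≫ 𝓘.Φ.map a' ≫ (phiObj 𝓘 X s').hom)
      (𝓘.Φ.map a ≫ (phiObj 𝓘 X s).hom) := by
  obtain ⟨rfl, _⟩ := id hf
  exact of_eq (by rw [← 𝓘.Φ.map_comp_assoc, hf.eq])

/-- By naturality only the shapes matter. The weight bound makes at least two of the three empty,
which leaves four identities between unitors. -/
theorem agree_associator {U V W : A} {r s t : SlotShape A} (a : U ⟶ r.obj 𝓘 X)
    (b : V ⟶ s.obj 𝓘 X) (c : W ⟶ t.obj 𝓘 X) (h : r.weight + s.weight + t.weight ≤ 1) :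
    Agree 𝓘 ((α_ U V W).hom ≫ (a ⊗ₘ ((b ⊗ₘ c) ≫ (tensorObj 𝓘 X s t).hom)) ≫
        (tensorObj 𝓘 X r (s.tensor 𝓘 X t)).hom)
      ((((a ⊗ₘ b) ≫ (tensorObj 𝓘 X r s).hom) ⊗ₘ c) ≫
        (tensorObj 𝓘 X (r.tensor 𝓘 X s) t).hom) := by
  have h₁ : (a ⊗ₘ ((b ⊗ₘ c) ≫ (tensorObj 𝓘 X s t).hom)) =
      (a ⊗ₘ (b ⊗ₘ c)) ≫ (_ ◁ (tensorObj 𝓘 X s t).hom) := by simp [MonoidalCategory.tensorHom_def]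
  have h₂ : (((a ⊗ₘ b) ≫ (tensorObj 𝓘 X r s).hom) ⊗ₘ c) =
      ((a ⊗ₘ b) ⊗ₘ c) ≫ ((tensorObj 𝓘 X r s).hom ▷ _) := by
    simp [MonoidalCategory.tensorHom_def']
  rw [h₁, h₂, Category.assoc, Category.assoc, ← associator_naturality_assoc]
  apply Agree.precomp
  clear h₁ h₂ a b c
  cases r <;> cases s <;> cases t <;> simp only [weight] at h <;> try omega
  · exact .of_eq (by simp [tensorObj, obj, tensor, unitors_equal])
  · exact .of_eq (by simp [tensorObj, obj, tensor])
  · exact .of_eq (by simp [tensorObj, obj, tensor])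
  · exact .of_eq (by simp [tensorObj, obj, tensor])

theorem agree_leftUnitor {U : A} {s : SlotShape A} (a : U ⟶ s.obj 𝓘 X) :
    Agree 𝓘 ((λ_ U).hom ≫ a) ((𝟙 (𝟙_ A) ⊗ₘ a) ≫ (tensorObj 𝓘 X empty s).hom) :=
  .of_eq (show _ = (𝟙 (𝟙_ A) ⊗ₘ a) ≫ (λ_ (s.obj 𝓘 X)).hom by simp)

theorem agree_rightUnitor {U : A} {s : SlotShape A} (a : U ⟶ s.obj 𝓘 X) :
    Agree 𝓘 ((ρ_ U).hom ≫ a) ((a ⊗ₘ 𝟙 (𝟙_ A)) ≫ (tensorObj 𝓘 X s empty).hom) := by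
  have h : (ρ_ U).hom ≫ a = (a ⊗ₘ 𝟙 (𝟙_ A)) ≫ (ρ_ (s.obj 𝓘 X)).hom := by simp
  cases s
  -- `tensorObj` reduces two empty shapes by the left unitor.
  · exact .of_eq (h.trans (congrArg (fun k => (a ⊗ₘ 𝟙 (𝟙_ A)) ≫ k) unitors_equal.symm))
  · exact .of_eq h
  · exact .of_eq h

theorem agree_phiTwo {U V : A} {s t : SlotShape A} (a : U ⟶ s.obj 𝓘 X) (b : V ⟶ t.obj 𝓘 X)
    (h : s.weight + t.weight ≤ 1) :
    Agree 𝓘 ((𝓘.Φ₂ U V).hom ≫ 𝓘.Φ.map ((a ⊗ₘ b) ≫ (tensorObj 𝓘 X s t).hom) ≫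
        (phiObj 𝓘 X (s.tensor 𝓘 X t)).hom)
      (((𝓘.Φ.map b ≫ (phiObj 𝓘 X t).hom) ⊗ₘ (𝓘.Φ.map a ≫ (phiObj 𝓘 X s).hom)) ≫
        (tensorObj 𝓘 X (t.phi 𝓘) (s.phi 𝓘)).hom) := by
  rw [𝓘.Φ.map_comp, Category.assoc, ← reassoc_of% (𝓘.Φ₂_natural a b),
    ← tensorHom_comp_tensorHom, Category.assoc]
  apply Agree.precomp
  cases s <;> cases t <;> simp only [weight] at h <;> try omega
  · refine .of_eq ((𝓘.Φ₂_comp_map_leftUnitor (Y := 𝟙_ A) 𝓘.Φ₀.hom).trans ?_)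
    exact congrArg (fun k => (𝓘.Φ₀.hom ⊗ₘ 𝓘.Φ₀.hom) ≫ k) unitors_equal.symm
  · exact .of_eq (𝓘.Φ₂_comp_map_leftUnitor _)
  · exact .of_eq (𝓘.Φ₂_comp_map_rightUnitor _)

theorem agree_phiZero : Agree (X := X) (s := empty) 𝓘 (𝓘.Φ₀.hom ≫ 𝟙 (𝟙_ A))
    (𝓘.Φ.map (𝟙 (𝟙_ A)) ≫ (phiObj 𝓘 X empty).hom) :=
  .of_eq (by simp [phiObj, obj, phi])

/-- The shape `𝟙_ A` needs `t_unit`, the shape `Φ X` needs `Φ(t) = tΦ`, and the shape `X` needs only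
functoriality. -/
theorem agree_t {U : A} {s : SlotShape A} (a : U ⟶ s.obj 𝓘 X) (h : s.weight ≤ 1) :
    Agree 𝓘 (𝓘.t.hom.app U ≫ a)
      (𝓘.Φ.map (𝓘.Φ.map a ≫ (phiObj 𝓘 X s).hom) ≫ (phiObj 𝓘 X (s.phi 𝓘)).hom) := by
  have ht : 𝓘.Φ.map (𝓘.Φ.map a) ≫ 𝓘.t.hom.app (s.obj 𝓘 X) = 𝓘.t.hom.app U ≫ a :=
    𝓘.t.hom.naturality a
  rw [← ht, 𝓘.Φ.map_comp, Category.assoc]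
  apply Agree.precomp
  match s with
  | empty => exact .of_eq 𝓘.t_unit
  | var false =>
    refine .of_eq (?_ : 𝓘.t.hom.app X = 𝓘.Φ.map (𝟙 (𝓘.Φ.obj X)) ≫ 𝓘.t.hom.app X)
    simp
  | var true =>
    refine .of_eq (?_ : 𝓘.t.hom.app (𝓘.Φ.obj X) = 𝓘.Φ.map (𝓘.t.hom.app X) ≫ 𝟙 (𝓘.Φ.obj X))
    simp [𝓘.Φ_map_t]

/-- One of the two factors is a unit, so the braiding is a composite of unitors. The bound is
essential: `β_ X X` need not be the identity. -/
theorem agree_braiding {A : Type u₁} [Category.{v₁} A] [MonoidalCategory A] [BraidedCategory A]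
    {𝓘 : AntiInvolution A} {X : A} {U V : A} {s t : SlotShape A} (a : U ⟶ s.obj 𝓘 X)
    (b : V ⟶ t.obj 𝓘 X) (h : s.weight + t.weight ≤ 1) :
    Agree 𝓘 ((β_ U V).hom ≫ (b ⊗ₘ a) ≫ (tensorObj 𝓘 X t s).hom)
      ((a ⊗ₘ b) ≫ (tensorObj 𝓘 X s t).hom) := by
  rw [← BraidedCategory.braiding_naturality_assoc]
  apply Agree.precomp
  clear a b
  cases s <;> cases t <;> simp only [weight] at h <;> try omega
  · exact .of_eq (by simp [tensorObj, obj, tensor, ← unitors_equal])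
  · exact .of_eq (by simp [tensorObj, obj, tensor])
  · exact .of_eq (by simp [tensorObj, obj, tensor])

end SlotShape

/-! ### Structural isomorphisms on tuples concentrated in one slot -/

namespace Z2BraidedPair

variable {A : Type u₁} [Category.{v₁} A] [MonoidalCategory A] [BraidedCategory A]
  {M : Type u₂} [Category.{v₂} M] [MonoidalRightAction A M] (𝓟 : Z2BraidedPair A M) {n : ℕ}

/-- Carries the bound on occurrences to inverses and to the middle expression of a composite. -/
theorem IsStructuralA.countP_eq {𝓟 : Z2BraidedPair A M} {U V : AWord n} {f : 𝓟.evalA U ≅ 𝓟.evalA V}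
    (hf : 𝓟.IsStructuralA f) (p : Fin n → Bool) : U.vars.countP p = V.vars.countP p := by
  induction hf <;> simp_all [AWord.vars] <;> omega

/-- The tuple with entry `X` in the slots in `p` and the unit object elsewhere. -/
def slot (p : Fin n → Bool) (X : A) : Fin n → A := fun j => if p j then X else 𝟙_ A

/-- The shape of an expression in which the variables that are not in `p` are set to `𝟙`. -/
def shape (p : Fin n → Bool) (X : A) : AWord n → SlotShape A
  | .var j => if p j then .var false else .empty
  | .unit => .empty
  | .tensor U V => (shape p X U).tensor 𝓟.toAntiInvolution X (shape p X V)
  | .phi U => (shape p X U).phi 𝓟.toAntiInvolution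

theorem weight_shape_le (p : Fin n → Bool) (X : A) (U : AWord n) :
    (𝓟.shape p X U).weight ≤ U.vars.countP p := by
  induction U with
  | var j =>
    by_cases h : p j <;> simp [shape, h, AWord.vars, SlotShape.weight]
  | unit => simp [shape, SlotShape.weight]
  | tensor U V hU hV =>
    rw [AWord.countP_tensor]
    exact (SlotShape.weight_tensor _ _ _ _).trans (add_le_add hU hV)
  | phi U hU => exact (SlotShape.weight_phi _ _).trans_le hU

/-- The reduction of the value of an expression at `slot p X` to its normal form. -/
def slotIso (p : Fin n → Bool) (X : A) : ∀ U : AWord n,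
    (𝓟.evalA U).obj (slot p X) ≅ (𝓟.shape p X U).obj 𝓟.toAntiInvolution X
  | .var j => eqToIso (by
      by_cases h : p j <;> simp [slot, shape, h, evalA, SlotShape.obj])
  | .unit => Iso.refl (𝟙_ A)
  | .tensor U V => (slotIso p X U ⊗ᵢ slotIso p X V) ≪≫ SlotShape.tensorObj _ _ _ _
  | .phi U => 𝓟.Φ.mapIso (slotIso p X U) ≪≫ SlotShape.phiObj _ _ _

/-- The reductions depend on the expressions alone, so this determines `f` at `slot p X` from its
source and target. -/
theorem IsStructuralA.agree {𝓟 : Z2BraidedPair A M} {U V : AWord n} {f : 𝓟.evalA U ≅ 𝓟.evalA V}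
    (hf : 𝓟.IsStructuralA f) {p : Fin n → Bool} (X : A) (hU : U.vars.countP p ≤ 1) :
    SlotShape.Agree 𝓟.toAntiInvolution (f.hom.app (slot p X) ≫ (𝓟.slotIso p X V).hom)
      (𝓟.slotIso p X U).hom := by
  induction hf with
  | refl U => exact .of_eq (by simp)
  | symm hf ih =>
    rename_i f
    refine .trans ((ih (by rwa [hf.countP_eq])).symm.precomp _) (.of_eq ?_)
    exact Iso.inv_hom_id_assoc (f.app (slot p X)) _
  | trans hf hg ihf ihg =>
    rename_i f g
    refine .trans (.of_eq (Category.assoc _ _ _)) ?_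
    exact ((ihg (by rwa [← hf.countP_eq])).precomp _).trans (ihf hU)
  | tensor _ _ ihf ihg =>
    rw [AWord.countP_tensor] at hU
    exact (ihf (by omega)).tensor (ihg (by omega))
  | phi _ ih => exact (ih hU).phi
  | alpha U V W =>
    rw [AWord.countP_tensor, AWord.countP_tensor] at hU
    have h₁ := 𝓟.weight_shape_le p X U
    have h₂ := 𝓟.weight_shape_le p X V
    have h₃ := 𝓟.weight_shape_le p X W
    exact SlotShape.agree_associator _ _ _ (by omega)
  | lambda U => exact SlotShape.agree_leftUnitor _
  | rho U => exact SlotShape.agree_rightUnitor _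
  | sigma U V =>
    rw [AWord.countP_tensor] at hU
    have h₁ := 𝓟.weight_shape_le p X U
    have h₂ := 𝓟.weight_shape_le p X V
    exact SlotShape.agree_braiding _ _ (by omega)
  | phiTwo U V =>
    rw [AWord.countP_tensor] at hU
    have h₁ := 𝓟.weight_shape_le p X U
    have h₂ := 𝓟.weight_shape_le p X V
    exact SlotShape.agree_phiTwo _ _ (by
      have : (AWord.phi V).vars = V.vars := rfl
      have : (AWord.phi U).vars = U.vars := rfl
      simp_all; omega)
  | phiZero => exact SlotShape.agree_phiZero
  | t U => exact SlotShape.agree_t _ ((𝓟.weight_shape_le p X U).trans hU)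

/-- Parallel structural isomorphisms agree on tuples concentrated in one slot. -/
theorem IsStructuralA.app_slot_eq {𝓟 : Z2BraidedPair A M} {U V : AWord n} {f g : 𝓟.evalA U ≅ 𝓟.evalA V}
    (hf : 𝓟.IsStructuralA f) (hg : 𝓟.IsStructuralA g) {p : Fin n → Bool} (X : A)
    (hU : U.vars.countP p ≤ 1) : f.hom.app (slot p X) = g.hom.app (slot p X) := by
  rw [← cancel_mono (𝓟.slotIso p X V).hom]
  exact ((hf.agree X hU).trans (hg.agree X hU).symm).eq

theorem app_eq_of_iso {𝓟 : Z2BraidedPair A M} {U V : AWord n} {f g : 𝓟.evalA U ≅ 𝓟.evalA V} {x y : Fin n → A}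
    (e : ∀ j, Nonempty (x j ≅ y j)) (h : f.hom.app y = g.hom.app y) :
    f.hom.app x = g.hom.app x := by
  let φ : x ≅ y := Pi.isoMk fun j => (e j).some
  refine (cancel_mono ((𝓟.evalA V).mapIso φ).hom).1 ?_
  rw [Functor.mapIso_hom, ← f.hom.naturality, ← g.hom.naturality, h]

end Z2BraidedPair

/-! ### Coherence in `A` -/

namespace Z2BraidedPair

variable {A : Type u₁} [Category.{v₁} A] [MonoidalCategory A] [SymmetricCategory A]
  {M : Type u₂} [Category.{v₂} M] [MonoidalRightAction A M] (𝓟 : Z2BraidedPair A M) {n : ℕ}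

theorem IsStructuralA.app_tensor_eq {𝓟 : Z2BraidedPair A M} {U V : AWord n} {f g : 𝓟.evalA U ≅ 𝓟.evalA V}
    (hf : 𝓟.IsStructuralA f) (hg : 𝓟.IsStructuralA g) {y z : Fin n → A}
    (hy : f.hom.app y = g.hom.app y) (hz : f.hom.app z = g.hom.app z) :
    f.hom.app (fun j => y j ⊗ z j) = g.hom.app (fun j => y j ⊗ z j) := by
  rw [← cancel_epi (𝓟.evalTensor y z U).hom, ← hf.tensor_comp_evalTensor,
    ← hg.tensor_comp_evalTensor, hy, hz]

/-- Coherence for braided anti-involutions of symmetric monoidal categories. -/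
theorem IsStructuralA.eq {𝓟 : Z2BraidedPair A M} {U V : AWord n} (hU : U.IsLinear) {f g : 𝓟.evalA U ≅ 𝓟.evalA V}
    (hf : 𝓟.IsStructuralA f) (hg : 𝓟.IsStructuralA g) : f = g := by
  classical
  -- The slots are filled one at a time, starting from the tuple of units.
  have key (x : Fin n → A) (S : Finset (Fin n)) :
      f.hom.app (fun j => if j ∈ S then x j else 𝟙_ A) =
        g.hom.app (fun j => if j ∈ S then x j else 𝟙_ A) := by
    induction S using Finset.induction_on with
    | empty =>
      refine app_eq_of_iso (y := slot (fun _ => false) (𝟙_ A)) (fun j => ⟨Iso.refl _⟩)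
        (hf.app_slot_eq hg _ (by rw [List.countP_eq_zero.2 (by simp)]; exact zero_le_one))
    | insert a S ha ih =>
      -- The tuple for `insert a S` is, up to unitors, the tensor product of the one concentrated at
      -- `a` and the one for `S`.
      refine app_eq_of_iso (fun j => ?_)
        (hf.app_tensor_eq hg (hf.app_slot_eq hg (p := fun j => j == a) (x a) (hU a).le) ih)
      by_cases hj : j = a
      · subst hj
        simpa [slot, ha] using ⟨(ρ_ (x j)).symm⟩
      · simpa [slot, hj] using ⟨(λ_ _).symm⟩
  ext x
  exact app_eq_of_iso (fun j => ⟨eqToIso (by simp)⟩) (key x Finset.univ)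

end Z2BraidedPair

/-! ### Interchange of acting objects -/

namespace CategoryTheory.MonoidalCategory.MonoidalRightAction

variable {A : Type u₁} [Category.{v₁} A] [MonoidalCategory A]
  {M : Type u₂} [Category.{v₂} M] [MonoidalRightAction A M]

theorem actionHomRight_associator_hom (m : M) (X Y Z : A) :
    m ⊴ᵣ (α_ X Y Z).hom = (αᵣ m (X ⊗ Y) Z).hom ≫ (αᵣ m X Y).hom ⊵ᵣ Z ≫
      (αᵣ (m ⊙ᵣ X) Y Z).inv ≫ (αᵣ m X (Y ⊗ Z)).inv := by
  rw [← actionHom_associator_assoc]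
  simp

theorem actionHomRight_associator_inv (m : M) (X Y Z : A) :
    m ⊴ᵣ (α_ X Y Z).inv = (αᵣ m X (Y ⊗ Z)).hom ≫ (αᵣ (m ⊙ᵣ X) Y Z).hom ≫
      (αᵣ m X Y).inv ⊵ᵣ Z ≫ (αᵣ m (X ⊗ Y) Z).inv := by
  rw [← cancel_epi (m ⊴ᵣ (α_ X Y Z).hom), actionHomRight_hom_inv,
    actionHomRight_associator_hom]
  simp

theorem actionHomLeft_tensor_comp {m m' : M} (f : m ⟶ m') (X Y : A) :
    f ⊵ᵣ (X ⊗ Y) ≫ (αᵣ m' X Y).hom = (αᵣ m X Y).hom ≫ (f ⊵ᵣ X) ⊵ᵣ Y := by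
  simp

theorem actionAssocIso_inv_comp {m m' : M} (f : m ⟶ m') (X Y : A) :
    (αᵣ m X Y).inv ≫ f ⊵ᵣ (X ⊗ Y) = (f ⊵ᵣ X) ⊵ᵣ Y ≫ (αᵣ m' X Y).inv := by
  simp

variable [BraidedCategory A]

/-- The interchange of two objects acting on `m`. -/
def swap (m : M) (X Y : A) : (m ⊙ᵣ X) ⊙ᵣ Y ⟶ (m ⊙ᵣ Y) ⊙ᵣ X :=
  (αᵣ m X Y).inv ≫ m ⊴ᵣ (β_ X Y).hom ≫ (αᵣ m Y X).hom

theorem swap_natural {m m' : M} (f : m ⟶ m') (X Y : A) :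
    (f ⊵ᵣ X) ⊵ᵣ Y ≫ swap m' X Y = swap m X Y ≫ (f ⊵ᵣ Y) ⊵ᵣ X := by
  simp only [swap, Category.assoc, ← actionHomLeft_tensor_comp]
  rw [← reassoc_of% @actionAssocIso_inv_comp, ← action_exchange_assoc]

theorem actionHomRight_braiding_comp (m : M) (X Y : A) :
    m ⊴ᵣ (β_ X Y).hom ≫ (αᵣ m Y X).hom = (αᵣ m X Y).hom ≫ swap m X Y := by
  simp [swap]

theorem swap_comp_actionAssocIso_inv (m : M) (X Y : A) :
    swap m X Y ≫ (αᵣ m Y X).inv = (αᵣ m X Y).inv ≫ m ⊴ᵣ (β_ X Y).hom := by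
  simp [swap]

/-- The hexagon for `β_ Z (X ⊗ Y)`, acting on `m`; it makes tensor products of central isomorphisms
central. -/
theorem swap_hexagon (m : M) (Z X Y : A) :
    (αᵣ (m ⊙ᵣ Z) X Y).hom ≫ swap m Z X ⊵ᵣ Y ≫ swap (m ⊙ᵣ X) Z Y =
      swap m Z (X ⊗ Y) ≫ (αᵣ m X Y).hom ⊵ᵣ Z := by
  simp only [swap, BraidedCategory.braiding_tensor_right_hom, actionHomRight_comp,
    actionHomRight_whiskerRight, whiskerRight_actionHomLeft, actionHomRight_associator_hom,
    actionHomRight_associator_inv, comp_actionHomLeft, Category.assoc, Iso.inv_hom_id_assoc,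
    inv_hom_actionHomLeft, Category.comp_id]

end CategoryTheory.MonoidalCategory.MonoidalRightAction

namespace CategoryTheory.MonoidalCategory.MonoidalRightAction

variable {A : Type u₁} [Category.{v₁} A] [MonoidalCategory A] [SymmetricCategory A]
  {M : Type u₂} [Category.{v₂} M] [MonoidalRightAction A M]

@[simp]
theorem swap_swap (m : M) (X Y : A) : swap m X Y ≫ swap m Y X = 𝟙 _ := by
  simp only [swap, Category.assoc, Iso.hom_inv_id_assoc]
  rw [← actionHomRight_comp_assoc, SymmetricCategory.symmetry]
  simp

end CategoryTheory.MonoidalCategory.MonoidalRightAction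

/-! ### Central isomorphisms between actions -/

open MonoidalRightAction

/-- A natural isomorphism between the functors by which two objects act on `M` that is compatible
with the action of all other objects. -/
structure CentralIso {A : Type u₁} [Category.{v₁} A] [MonoidalCategory A] [BraidedCategory A]
    (M : Type u₂) [Category.{v₂} M] [MonoidalRightAction A M] (X Y : A) where
  /-- the components -/
  app (m : M) : m ⊙ᵣ X ≅ m ⊙ᵣ Y
  natural {m m' : M} (f : m ⟶ m') : f ⊵ᵣ X ≫ (app m').hom = (app m).hom ≫ f ⊵ᵣ Y
  central (m : M) (Z : A) :
    (app (m ⊙ᵣ Z)).hom ≫ swap m Z Y = swap m Z X ≫ (app m).hom ⊵ᵣ Z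

namespace CentralIso

section

variable {A : Type u₁} [Category.{v₁} A] [MonoidalCategory A] [BraidedCategory A]
  {M : Type u₂} [Category.{v₂} M] [MonoidalRightAction A M] {X Y Z W X' Y' : A}

/-- The identity. -/
def refl (X : A) : CentralIso M X X where
  app _ := Iso.refl _
  natural := by simp
  central := by simp

/-- Composition. -/
def trans (k : CentralIso M X Y) (l : CentralIso M Y Z) : CentralIso M X Z where
  app m := k.app m ≪≫ l.app m
  natural f := by simp [natural, reassoc_of% @natural]
  central m Z := by simp [central, reassoc_of% @central]

/-- Inversion. -/
def symm (k : CentralIso M X Y) : CentralIso M Y X where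
  app m := (k.app m).symm
  natural f := by simp [Iso.comp_inv_eq, natural]
  central m Z := by
    rw [← cancel_mono ((k.app m).hom ⊵ᵣ Z), Category.assoc, ← central]
    simp

/-- The tensor product. -/
def tensor (k : CentralIso M X Y) (l : CentralIso M X' Y') :
    CentralIso M (X ⊗ X') (Y ⊗ Y') where
  app m := αᵣ m X X' ≪≫ l.app (m ⊙ᵣ X) ≪≫
    (⟨(k.app m).hom ⊵ᵣ Y', (k.app m).inv ⊵ᵣ Y', by simp, by simp⟩ :
      (m ⊙ᵣ X) ⊙ᵣ Y' ≅ (m ⊙ᵣ Y) ⊙ᵣ Y') ≪≫ (αᵣ m Y Y').symm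
  natural f := by
    simp only [Iso.trans_hom, Iso.symm_hom, Category.assoc, reassoc_of% @actionHomLeft_tensor_comp,
      reassoc_of% @natural, actionAssocIso_inv_comp, ← comp_actionHomLeft_assoc, natural]
  central m Z := by
    have h : (αᵣ (m ⊙ᵣ Z) Y Y').inv ≫ swap m Z (Y ⊗ Y') =
        swap m Z Y ⊵ᵣ Y' ≫ swap (m ⊙ᵣ Y) Z Y' ≫ (αᵣ m Y Y').inv ⊵ᵣ Z := by
      rw [Iso.inv_comp_eq, reassoc_of% @swap_hexagon]
      simp
    simp only [Iso.trans_hom, Iso.symm_hom, Category.assoc, h, comp_actionHomLeft]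
    rw [← comp_actionHomLeft_assoc, central, comp_actionHomLeft_assoc, reassoc_of% @swap_natural,
      ← reassoc_of% @natural, reassoc_of% @central, reassoc_of% @swap_hexagon]

theorem tensor_app_hom (k : CentralIso M X Y) (l : CentralIso M X' Y') (m : M) :
    ((k.tensor l).app m).hom = (αᵣ m X X').hom ≫ (l.app (m ⊙ᵣ X)).hom ≫
      (k.app m).hom ⊵ᵣ Y' ≫ (αᵣ m Y Y').inv := rfl

/-- The hypotheses say that `f'` and `g'` are what `f` and `g` become under the given central
isomorphisms. This relation is what the deletion of `Φ` has to preserve. -/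
theorem tensor_natural {V V' W W' : A} {f : X ⟶ X'} {f' : Y ⟶ Y'} {g : V ⟶ V'} {g' : W ⟶ W'}
    {k : CentralIso M X Y} {k' : CentralIso M X' Y'} {l : CentralIso M V W}
    {l' : CentralIso M V' W'}
    (hf : ∀ m : M, m ⊴ᵣ f ≫ (k'.app m).hom = (k.app m).hom ≫ m ⊴ᵣ f')
    (hg : ∀ m : M, m ⊴ᵣ g ≫ (l'.app m).hom = (l.app m).hom ≫ m ⊴ᵣ g') (m : M) :
    m ⊴ᵣ (f ⊗ₘ g) ≫ ((k'.tensor l').app m).hom =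
      ((k.tensor l).app m).hom ≫ m ⊴ᵣ (f' ⊗ₘ g') := by
  have h₁ : m ⊴ᵣ (f ⊗ₘ g) ≫ (αᵣ m X' V').hom =
      (αᵣ m X V).hom ≫ (m ⊴ᵣ f) ⊵ᵣ V ≫ (m ⊙ᵣ X') ⊴ᵣ g := by
    rw [← id_actionHom, actionAssocIso_hom_naturality, id_actionHom, actionHom_def]
  have h₂ : (αᵣ m Y W).inv ≫ m ⊴ᵣ (f' ⊗ₘ g') =
      (m ⊙ᵣ Y) ⊴ᵣ g' ≫ (m ⊴ᵣ f') ⊵ᵣ W' ≫ (αᵣ m Y' W').inv := by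
    rw [← id_actionHom, ← actionAssocIso_inv_naturality, id_actionHom, actionHom_def',
      Category.assoc]
  simp only [tensor_app_hom, Category.assoc, h₂]
  rw [reassoc_of% h₁, reassoc_of% (hg (m ⊙ᵣ X')), ← action_exchange_assoc,
    ← comp_actionHomLeft_assoc, reassoc_of% @natural, ← action_exchange_assoc,
    ← comp_actionHomLeft_assoc, hf]

theorem tensor_associator (k : CentralIso M X Y) (l : CentralIso M X' Y') (p : CentralIso M Z W)
    (m : M) :
    m ⊴ᵣ (α_ X X' Z).hom ≫ ((k.tensor (l.tensor p)).app m).hom =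
      (((k.tensor l).tensor p).app m).hom ≫ m ⊴ᵣ (α_ Y Y' W).hom := by
  simp only [tensor_app_hom, Category.assoc, actionHomRight_associator_hom, comp_actionHomLeft,
    Iso.inv_hom_id_assoc, inv_hom_actionHomLeft_assoc]
  rw [reassoc_of% @actionAssocIso_inv_comp, reassoc_of% @natural]

theorem tensor_leftUnitor (k : CentralIso M X Y) (m : M) :
    m ⊴ᵣ (λ_ X).hom ≫ (k.app m).hom =
      (((refl (𝟙_ A)).tensor k).app m).hom ≫ m ⊴ᵣ (λ_ Y).hom := by
  simp [tensor_app_hom, refl, natural]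

theorem tensor_rightUnitor (k : CentralIso M X Y) (m : M) :
    m ⊴ᵣ (ρ_ X).hom ≫ (k.app m).hom =
      ((k.tensor (refl (𝟙_ A))).app m).hom ≫ m ⊴ᵣ (ρ_ Y).hom := by
  simp [tensor_app_hom, refl]

theorem trans_tensor_trans {V : A} (k : CentralIso M X Y) (l : CentralIso M Y Z)
    (k' : CentralIso M X' Y') (l' : CentralIso M Y' V) (m : M) :
    (((k.trans l).tensor (k'.trans l')).app m).hom =
      ((k.tensor k').app m).hom ≫ ((l.tensor l').app m).hom := by
  simp only [tensor_app_hom, trans, Iso.trans_hom, Category.assoc, comp_actionHomLeft,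
    Iso.inv_hom_id_assoc]
  rw [reassoc_of% @natural]

theorem symm_tensor_symm (k : CentralIso M X Y) (l : CentralIso M X' Y') (m : M) :
    ((k.symm.tensor l.symm).app m).hom = ((k.tensor l).app m).inv := by
  rw [← cancel_mono ((k.tensor l).app m).hom, ← trans_tensor_trans, Iso.inv_hom_id]
  simp [tensor_app_hom, trans, symm]

/-- An isomorphism acts centrally. -/
def ofIso (f : X ≅ Y) : CentralIso M X Y where
  app m := ⟨m ⊴ᵣ f.hom, m ⊴ᵣ f.inv, by simp, by simp⟩
  natural g := (action_exchange g f.hom).symm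
  central m Z := by
    have h : (m ⊴ᵣ f.hom) ⊵ᵣ Z = (αᵣ m X Z).inv ≫ m ⊴ᵣ (f.hom ▷ Z) ≫ (αᵣ m Y Z).hom := by simp
    simp only [swap, action_actionHomRight, Category.assoc, h, Iso.hom_inv_id_assoc]
    rw [← actionHomRight_comp_assoc, ← actionHomRight_comp_assoc,
      BraidedCategory.braiding_naturality_right]

theorem ofIso_tensor_ofIso (f : X ≅ Y) (g : X' ≅ Y') (m : M) :
    (((ofIso f).tensor (ofIso g)).app m).hom = m ⊴ᵣ (f.hom ⊗ₘ g.hom) := by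
  rw [← cancel_mono (αᵣ m Y Y').hom, ← id_actionHom, actionAssocIso_hom_naturality, id_actionHom,
    actionHom_def', tensor_app_hom]
  simp [ofIso]

/-- `L` plays the flattening of an expression and `k` the deletion of `Φ` in the next acting object;
together they form one step of `flattenIso`. -/
theorem act_natural {m p p' : M} {T T' : A} {F : p ⟶ p'} {L : p ⟶ m ⊙ᵣ T} {L' : p' ⟶ m ⊙ᵣ T'}
    {φ : T ⟶ T'} {u : X ⟶ X'} {γ : Y ⟶ Y'} {k : CentralIso M X Y} {k' : CentralIso M X' Y'}
    (hF : F ≫ L' = L ≫ m ⊴ᵣ φ)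
    (hu : ∀ m : M, m ⊴ᵣ u ≫ (k'.app m).hom = (k.app m).hom ≫ m ⊴ᵣ γ) :
    (F ⊙ᵣₘ u) ≫ (k'.app p').hom ≫ L' ⊵ᵣ Y' ≫ (αᵣ m T' Y').inv =
      ((k.app p).hom ≫ L ⊵ᵣ Y ≫ (αᵣ m T Y).inv) ≫ m ⊴ᵣ (φ ⊗ₘ γ) := by
  have h : (αᵣ m T Y).inv ≫ m ⊴ᵣ (φ ⊗ₘ γ) =
      (m ⊙ᵣ T) ⊴ᵣ γ ≫ (m ⊴ᵣ φ) ⊵ᵣ Y' ≫ (αᵣ m T' Y').inv := by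
    rw [← id_actionHom, ← actionAssocIso_inv_naturality, id_actionHom, actionHom_def',
      Category.assoc]
  simp only [Category.assoc, h]
  rw [actionHom_def', Category.assoc, reassoc_of% @natural, reassoc_of% (hu p), ← action_exchange_assoc,
    ← comp_actionHomLeft_assoc, hF, comp_actionHomLeft_assoc]

theorem act_associator {m p : M} {T : A} (L : p ⟶ m ⊙ᵣ T) (k : CentralIso M X Y)
    (k' : CentralIso M X' Y') :
    (αᵣ p X X').hom ≫ (k'.app (p ⊙ᵣ X)).hom ≫
        ((k.app p).hom ≫ L ⊵ᵣ Y ≫ (αᵣ m T Y).inv) ⊵ᵣ Y' ≫ (αᵣ m (T ⊗ Y) Y').inv =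
      (((k.tensor k').app p).hom ≫ L ⊵ᵣ (Y ⊗ Y') ≫ (αᵣ m T (Y ⊗ Y')).inv) ≫
        m ⊴ᵣ (α_ T Y Y').inv := by
  simp [tensor_app_hom, actionHomRight_associator_inv]

theorem act_unitor {m p : M} {T : A} (L : p ⟶ m ⊙ᵣ T) :
    (ρᵣ[A] p).hom ≫ L =
      (((refl (𝟙_ A)).app p).hom ≫ L ⊵ᵣ (𝟙_ A) ≫ (αᵣ m T (𝟙_ A)).inv) ≫ m ⊴ᵣ (ρ_ T).hom := by
  simp [refl]

end

variable {A : Type u₁} [Category.{v₁} A] [MonoidalCategory A] [SymmetricCategory A]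
  {M : Type u₂} [Category.{v₂} M] [MonoidalRightAction A M] {X Y X' Y' : A}

/-- Centrality and symmetry write `k` at `m ⊙ᵣ X'` as `k` at `m` conjugated by swaps, so `k` and `l`
may be applied to the factors in either order. -/
theorem tensor_braiding (k : CentralIso M X Y) (l : CentralIso M X' Y') (m : M) :
    m ⊴ᵣ (β_ X X').hom ≫ ((l.tensor k).app m).hom =
      ((k.tensor l).app m).hom ≫ m ⊴ᵣ (β_ Y Y').hom := by
  have h : (k.app (m ⊙ᵣ X')).hom = swap m X' X ≫ (k.app m).hom ⊵ᵣ X' ≫ swap m Y X' := by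
    rw [← reassoc_of% @central, swap_swap, Category.comp_id]
  simp only [tensor_app_hom, Category.assoc]
  rw [reassoc_of% @actionHomRight_braiding_comp, h, ← swap_comp_actionAssocIso_inv]
  simp only [Category.assoc, reassoc_of% @swap_swap]
  rw [← reassoc_of% @central, reassoc_of% @natural]

end CentralIso

/-! ### Deleting `Φ`, flattening, and coherence in `M` -/

/-- The expression obtained by deleting all occurrences of `Φ`. -/
def AWord.erasePhi {n : ℕ} : AWord n → AWord n
  | .var i => .var i
  | .unit => .unit
  | .tensor U V => .tensor U.erasePhi V.erasePhi
  | .phi U => U.erasePhi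

theorem AWord.vars_erasePhi {n : ℕ} (U : AWord n) : U.erasePhi.vars = U.vars := by
  induction U <;> simp_all [erasePhi, vars]

/-- The tensor product of all objects that act in an expression, with all `Φ` deleted. -/
def MWord.flatten {n : ℕ} : MWord n → AWord n
  | .base => .unit
  | .act P U => .tensor P.flatten U.erasePhi

theorem MWord.vars_flatten {n : ℕ} (P : MWord n) : P.flatten.vars = P.vars := by
  induction P <;> simp_all [flatten, vars, AWord.vars, AWord.vars_erasePhi]

namespace Z2BraidedPair

variable {A : Type u₁} [Category.{v₁} A] [MonoidalCategory A] [SymmetricCategory A]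
  {M : Type u₂} [Category.{v₂} M] [MonoidalRightAction A M] (𝓟 : Z2BraidedPair A M) {n : ℕ}

/-- The cylinder braiding as a central isomorphism. -/
def kappaCentral (X : A) : CentralIso M X (𝓟.Φ.obj X) where
  app m := 𝓟.κ m X
  natural f := by simpa using 𝓟.κ_natural f (𝟙 X)
  central m Z := by
    rw [𝓟.κ_act]
    -- BP1 is centrality with its last swap moved across, which symmetry allows.
    have h : swap m (𝓟.Φ.obj X) Z ≫ swap m Z (𝓟.Φ.obj X) = 𝟙 _ := swap_swap ..
    simp only [swap, Category.assoc] at h ⊢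
    rw [h, Category.comp_id]

theorem kappa_natural_right (m : M) {X Y : A} (f : X ⟶ Y) :
    m ⊴ᵣ f ≫ (𝓟.κ m Y).hom = (𝓟.κ m X).hom ≫ m ⊴ᵣ 𝓟.Φ.map f := by
  simpa using 𝓟.κ_natural (𝟙 m) f

/-- Centrality replaces the swap and the second `κ` of BP2 by `κ` at `m ⊙ᵣ Φ X`; the leftover swap
cancels the braiding in `mu`. -/
theorem kappa_tensor (m : M) (X Y : A) :
    (𝓟.κ m (X ⊗ Y)).hom =
      (((𝓟.kappaCentral X).tensor (𝓟.kappaCentral Y)).app m).hom ≫ m ⊴ᵣ (𝓟.mu X Y).hom := by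
  rw [CentralIso.tensor_app_hom, ← reassoc_of% @CentralIso.natural]
  have h : ((𝓟.kappaCentral Y).app (m ⊙ᵣ 𝓟.Φ.obj X)).hom =
      swap m (𝓟.Φ.obj X) Y ≫ (𝓟.κ m Y).hom ⊵ᵣ 𝓟.Φ.obj X ≫ swap m (𝓟.Φ.obj Y) (𝓟.Φ.obj X) := by
    rw [← Category.assoc]
    exact (by simp : _ = (_ ≫ swap m (𝓟.Φ.obj X) (𝓟.Φ.obj Y)) ≫ _).trans
      (congrArg (· ≫ _) ((𝓟.kappaCentral Y).central m (𝓟.Φ.obj X)))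
  rw [h, 𝓟.κ_tensor]
  simp [swap, AntiInvolution.mu, kappaCentral, ← actionHomRight_comp_assoc]

/-- Let `k` be the composite. Naturality along `λ_ (𝟙_ A)` and `kappa_tensor` make `k` idempotent up
to unitors; being invertible, it is the identity. -/
theorem kappa_unit (m : M) : (𝓟.κ m (𝟙_ A)).hom ≫ m ⊴ᵣ 𝓟.Φ₀.hom = 𝟙 _ := by
  have hΦ : m ⊴ᵣ (𝓟.mu (𝟙_ A) (𝟙_ A)).hom ≫ m ⊴ᵣ 𝓟.Φ.map (λ_ (𝟙_ A)).hom ≫ m ⊴ᵣ 𝓟.Φ₀.hom =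
      m ⊴ᵣ (𝓟.Φ₀.hom ⊗ₘ 𝓟.Φ₀.hom) ≫ m ⊴ᵣ (λ_ (𝟙_ A)).hom := by
    simp only [← actionHomRight_comp, 𝓟.Φ₀_comp_leftUnitor, Category.assoc]
  have h₁ := 𝓟.kappa_natural_right m (λ_ (𝟙_ A)).hom =≫ m ⊴ᵣ 𝓟.Φ₀.hom
  rw [Category.assoc, Category.assoc, kappa_tensor, Category.assoc, hΦ] at h₁
  let k : CentralIso M (𝟙_ A) (𝟙_ A) := (𝓟.kappaCentral (𝟙_ A)).trans (.ofIso 𝓟.Φ₀)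
  have h₂ : (((𝓟.kappaCentral (𝟙_ A)).tensor (𝓟.kappaCentral (𝟙_ A))).app m).hom ≫
      m ⊴ᵣ (𝓟.Φ₀.hom ⊗ₘ 𝓟.Φ₀.hom) = ((k.tensor k).app m).hom := by
    rw [CentralIso.trans_tensor_trans, CentralIso.ofIso_tensor_ofIso]
  change _ ≫ (k.app m).hom = _ at h₁
  rw [reassoc_of% h₂, CentralIso.tensor_app_hom, actionHom_leftUnitor, Category.assoc, k.natural,
    Category.assoc, Category.assoc, Category.assoc, Iso.inv_hom_id_assoc, cancel_epi, cancel_epi,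
    ← comp_actionHomLeft] at h₁
  change (k.app m).hom = _
  rw [← cancel_mono (ρᵣ[A] m).hom, Category.id_comp, ← cancel_epi (ρᵣ[A] _).hom,
    actionUnitIso_hom_naturality, ← h₁, ← actionUnitIso_hom_naturality]

/-- Deleting all occurrences of `Φ` by means of the cylinder braiding. -/
def eraseIso (x : Fin n → A) : ∀ U : AWord n,
    CentralIso M ((𝓟.evalA U).obj x) ((𝓟.evalA U.erasePhi).obj x)
  | .var i => .refl (x i)
  | .unit => .refl (𝟙_ A)
  | .tensor U V => (eraseIso x U).tensor (eraseIso x V)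
  | .phi U => (𝓟.kappaCentral ((𝓟.evalA U).obj x)).symm.trans (eraseIso x U)

/-- By `kappa_tensor`, deleting `Φ` trivialises `mu`; only the braiding by which `Φ₂` differs from
it survives. -/
theorem Φ₂_comp_kappa_inv (m : M) (X Y : A) {X' Y' : A} (k : CentralIso M X X')
    (l : CentralIso M Y Y') :
    m ⊴ᵣ (𝓟.Φ₂ X Y).hom ≫ ((𝓟.kappaCentral (X ⊗ Y)).symm.trans (k.tensor l) |>.app m).hom =
      ((((𝓟.kappaCentral Y).symm.trans l).tensor ((𝓟.kappaCentral X).symm.trans k)).app m).hom ≫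
        m ⊴ᵣ (β_ Y' X').hom := by
  have h : m ⊴ᵣ (𝓟.Φ₂ X Y).hom ≫ (𝓟.κ m (X ⊗ Y)).inv = m ⊴ᵣ (β_ _ _).hom ≫
      (((𝓟.kappaCentral X).tensor (𝓟.kappaCentral Y)).app m).inv := by
    rw [Iso.comp_inv_eq, kappa_tensor, 𝓟.Φ₂_eq]
    simp
  rw [← CentralIso.tensor_braiding, CentralIso.trans_tensor_trans, CentralIso.symm_tensor_symm]
  exact (Category.assoc _ _ _).symm.trans ((congrArg (· ≫ _) h).trans (Category.assoc _ _ _))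

theorem map_comp_kappa_inv {X Y X' Y' : A} {f : X ⟶ Y} {f' : X' ⟶ Y'} {k : CentralIso M X X'}
    {l : CentralIso M Y Y'} {m : M} (h : m ⊴ᵣ f ≫ (l.app m).hom = (k.app m).hom ≫ m ⊴ᵣ f') :
    m ⊴ᵣ 𝓟.Φ.map f ≫ ((𝓟.kappaCentral Y).symm.trans l |>.app m).hom =
      ((𝓟.kappaCentral X).symm.trans k |>.app m).hom ≫ m ⊴ᵣ f' := by
  have h' : m ⊴ᵣ 𝓟.Φ.map f ≫ (𝓟.κ m Y).inv = (𝓟.κ m X).inv ≫ m ⊴ᵣ f := by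
    rw [Iso.comp_inv_eq, Category.assoc, kappa_natural_right, Iso.inv_hom_id_assoc]
  simp only [CentralIso.trans, CentralIso.symm, kappaCentral, Iso.trans_hom, Iso.symm_hom,
    Category.assoc, ← h, reassoc_of% h']

theorem Φ₀_comp_kappa_inv (m : M) :
    m ⊴ᵣ 𝓟.Φ₀.hom ≫ ((CentralIso.refl (𝟙_ A)).app m).hom =
      ((𝓟.kappaCentral (𝟙_ A)).symm.trans (.refl (𝟙_ A)) |>.app m).hom ≫ m ⊴ᵣ 𝟙 (𝟙_ A) := by
  rw [← cancel_epi (𝓟.κ m (𝟙_ A)).hom, reassoc_of% (𝓟.kappa_unit m)]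
  simp [CentralIso.trans, CentralIso.symm, CentralIso.refl, kappaCentral]

theorem t_comp_kappa_inv {m : M} {X Y : A} (k : CentralIso M X Y)
    (h : (𝓟.κ m X).hom ≫ (𝓟.κ m (𝓟.Φ.obj X)).hom ≫ (m ⊴ᵣ 𝓟.t.hom.app X) = 𝟙 (m ⊙ᵣ X)) :
    m ⊴ᵣ 𝓟.t.hom.app X ≫ (k.app m).hom =
      ((𝓟.kappaCentral (𝓟.Φ.obj X)).symm.trans ((𝓟.kappaCentral X).symm.trans k) |>.app m).hom ≫
        m ⊴ᵣ 𝟙 Y := by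
  rw [← cancel_epi (𝓟.κ m (𝓟.Φ.obj X)).hom, ← cancel_epi (𝓟.κ m X).hom, reassoc_of% h]
  simp [CentralIso.trans, CentralIso.symm, kappaCentral]

/-- A structural isomorphism in `A` corresponds to a structural isomorphism between the
expressions without `Φ`. -/
theorem IsStructuralA.exists_erasePhi {𝓟 : Z2BraidedPair A M} {U V : AWord n}
    {f : 𝓟.evalA U ≅ 𝓟.evalA V}
    (hκ : ∀ (m : M) (X : A),
      (𝓟.κ m X).hom ≫ (𝓟.κ m (𝓟.Φ.obj X)).hom ≫ (m ⊴ᵣ 𝓟.t.hom.app X) = 𝟙 (m ⊙ᵣ X))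
    (hf : 𝓟.IsStructuralA f) :
    ∃ f' : 𝓟.evalA U.erasePhi ≅ 𝓟.evalA V.erasePhi, 𝓟.IsStructuralA f' ∧
      ∀ (x : Fin n → A) (m : M), m ⊴ᵣ f.hom.app x ≫ ((𝓟.eraseIso x V).app m).hom =
        ((𝓟.eraseIso x U).app m).hom ≫ m ⊴ᵣ f'.hom.app x := by
  induction hf with
  | refl U => exact ⟨_, .refl _, fun x m => by simp⟩
  | symm hf ih =>
    obtain ⟨f', hf', h⟩ := ih
    rename_i f
    refine ⟨_, hf'.symm, fun x m => ?_⟩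
    have h₁ : m ⊴ᵣ f.inv.app x ≫ m ⊴ᵣ f.hom.app x = 𝟙 _ := by
      rw [← actionHomRight_comp]; simp
    have h₂ : m ⊴ᵣ f'.hom.app x ≫ m ⊴ᵣ f'.inv.app x = 𝟙 _ := by
      rw [← actionHomRight_comp]; simp
    have := m ⊴ᵣ f.inv.app x ≫= (h x m) =≫ m ⊴ᵣ f'.inv.app x
    simp only [Category.assoc, h₂, reassoc_of% h₁, Category.comp_id] at this
    exact this.symm
  | trans _ _ ihf ihg =>
    obtain ⟨f', hf', hf⟩ := ihf
    obtain ⟨g', hg', hg⟩ := ihg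
    refine ⟨_, hf'.trans hg', fun x m => ?_⟩
    simp only [Iso.trans_hom, NatTrans.comp_app, actionHomRight_comp, Category.assoc, hg,
      reassoc_of% (hf x m)]
  | tensor _ _ ihf ihg =>
    obtain ⟨f', hf', hf⟩ := ihf
    obtain ⟨g', hg', hg⟩ := ihg
    exact ⟨_, hf'.tensor hg', fun x m => CentralIso.tensor_natural (hf x) (hg x) m⟩
  | phi _ ih =>
    obtain ⟨f', hf', hf⟩ := ih
    exact ⟨f', hf', fun x m => 𝓟.map_comp_kappa_inv (hf x m)⟩
  | alpha U V W =>
    exact ⟨_, .alpha _ _ _, fun x m => CentralIso.tensor_associator _ _ _ m⟩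
  | lambda U => exact ⟨_, .lambda _, fun x m => CentralIso.tensor_leftUnitor _ m⟩
  | rho U => exact ⟨_, .rho _, fun x m => CentralIso.tensor_rightUnitor _ m⟩
  | sigma U V => exact ⟨_, .sigma _ _, fun x m => CentralIso.tensor_braiding _ _ m⟩
  | phiTwo U V => exact ⟨_, .sigma _ _, fun x m => 𝓟.Φ₂_comp_kappa_inv m _ _ _ _⟩
  | phiZero => exact ⟨_, .refl _, fun x m => 𝓟.Φ₀_comp_kappa_inv m⟩
  | t U => exact ⟨_, .refl _, fun x m => 𝓟.t_comp_kappa_inv _ (hκ m _)⟩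

/-- Deletion of an outer `Φ` starts with the inverse of `κ`, so `κ` itself flattens to the identity.
-/
theorem kappa_comp_act {m p : M} {T X Y : A} (L : p ⟶ m ⊙ᵣ T) (k : CentralIso M X Y) :
    (𝓟.κ p X).hom ≫ ((𝓟.kappaCentral X).symm.trans k |>.app p).hom ≫ L ⊵ᵣ Y ≫ (αᵣ m T Y).inv =
      ((k.app p).hom ≫ L ⊵ᵣ Y ≫ (αᵣ m T Y).inv) ≫ m ⊴ᵣ 𝟙 (T ⊗ Y) := by
  simp [CentralIso.trans, CentralIso.symm, kappaCentral]

/-- Moving all objects that act in an expression into a single tensor product without `Φ`. -/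
def flattenIso (y : M × (Fin n → A)) : ∀ P : MWord n,
    (𝓟.evalM P).obj y ≅ y.1 ⊙ᵣ (𝓟.evalA P.flatten).obj y.2
  | .base => (ρᵣ[A] y.1).symm
  | .act P U => (𝓟.eraseIso y.2 U).app ((𝓟.evalM P).obj y) ≪≫
      (curriedAction A M |>.obj ((𝓟.evalA U.erasePhi).obj y.2)).mapIso (flattenIso y P) ≪≫
      (αᵣ y.1 ((𝓟.evalA P.flatten).obj y.2) ((𝓟.evalA U.erasePhi).obj y.2)).symm

theorem IsStructuralM.exists_flatten {𝓟 : Z2BraidedPair A M} {P Q : MWord n}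
    {f : 𝓟.evalM P ≅ 𝓟.evalM Q}
    (hκ : ∀ (m : M) (X : A),
      (𝓟.κ m X).hom ≫ (𝓟.κ m (𝓟.Φ.obj X)).hom ≫ (m ⊴ᵣ 𝓟.t.hom.app X) = 𝟙 (m ⊙ᵣ X))
    (hf : 𝓟.IsStructuralM f) :
    ∃ f' : 𝓟.evalA P.flatten ≅ 𝓟.evalA Q.flatten, 𝓟.IsStructuralA f' ∧
      ∀ y : M × (Fin n → A), f.hom.app y ≫ (𝓟.flattenIso y Q).hom =
        (𝓟.flattenIso y P).hom ≫ y.1 ⊴ᵣ f'.hom.app y.2 := by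
  induction hf with
  | refl U => exact ⟨_, .refl _, fun y => by simp⟩
  | symm hf ih =>
    obtain ⟨f', hf', h⟩ := ih
    rename_i f
    refine ⟨_, hf'.symm, fun y => ?_⟩
    have h₂ : y.1 ⊴ᵣ f'.hom.app y.2 ≫ y.1 ⊴ᵣ f'.inv.app y.2 = 𝟙 _ := by
      rw [← actionHomRight_comp]; simp
    have := f.inv.app y ≫= (h y) =≫ y.1 ⊴ᵣ f'.inv.app y.2
    simp only [Category.assoc, h₂, Iso.inv_hom_id_app_assoc, Category.comp_id] at this
    exact this.symm
  | trans _ _ ihf ihg =>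
    obtain ⟨f', hf', hf⟩ := ihf
    obtain ⟨g', hg', hg⟩ := ihg
    refine ⟨_, hf'.trans hg', fun y => ?_⟩
    simp only [Iso.trans_hom, NatTrans.comp_app, actionHomRight_comp, Category.assoc, hg,
      reassoc_of% (hf y)]
  | act _ hg ihf =>
    obtain ⟨f', hf', hf⟩ := ihf
    obtain ⟨g', hg', hg⟩ := hg.exists_erasePhi hκ
    exact ⟨_, hf'.tensor hg', fun y => CentralIso.act_natural (hf y) (hg y.2)⟩
  -- Flattening nests to the left, so `a` becomes the inverse associator.
  | a P U V => exact ⟨_, (IsStructuralA.alpha _ _ _).symm, fun y => CentralIso.act_associator _ _ _⟩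
  | r P => exact ⟨_, .rho _, fun y => CentralIso.act_unitor _⟩
  | kappa P U => exact ⟨_, .refl _, fun y => 𝓟.kappa_comp_act _ _⟩

/-- Coherence for the module category of a symmetric pair. -/
theorem IsStructuralM.eq {𝓟 : Z2BraidedPair A M} {P Q : MWord n} (hP : P.IsLinear)
    (hκ : ∀ (m : M) (X : A),
      (𝓟.κ m X).hom ≫ (𝓟.κ m (𝓟.Φ.obj X)).hom ≫ (m ⊴ᵣ 𝓟.t.hom.app X) = 𝟙 (m ⊙ᵣ X))
    {f g : 𝓟.evalM P ≅ 𝓟.evalM Q} (hf : 𝓟.IsStructuralM f) (hg : 𝓟.IsStructuralM g) : f = g := by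
  obtain ⟨f', hf', hf⟩ := hf.exists_flatten hκ
  obtain ⟨g', hg', hg⟩ := hg.exists_flatten hκ
  have hP' : P.flatten.IsLinear := fun i => by rw [MWord.vars_flatten]; exact hP i
  obtain rfl := hf'.eq hP' hg'
  ext y
  rw [← cancel_mono (𝓟.flattenIso y Q).hom, hf, hg]

end Z2BraidedPair

theorem mainTheorem4 {A : Type u₁} [Category.{v₁} A] [MonoidalCategory A] [BraidedCategory A]
    {M : Type u₂} [Category.{v₂} M] [MonoidalRightAction A M] (𝓟 : Z2SymmetricPair A M) (n : ℕ) :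
    (∀ (U V : AWord n), U.IsLinear → V.IsLinear →
      ∀ f g : 𝓟.evalA U ≅ 𝓟.evalA V, 𝓟.IsStructuralA f → 𝓟.IsStructuralA g → f = g) ∧
    (∀ (P Q : MWord n), P.IsLinear → Q.IsLinear →
      ∀ f g : 𝓟.evalM P ≅ 𝓟.evalM Q, 𝓟.IsStructuralM f → 𝓟.IsStructuralM g → f = g) := by
  -- This structure extends the given braiding, so the denoted functors are unchanged.
  let _ : SymmetricCategory A := { symmetry := 𝓟.σ_sq }
  exact ⟨fun U V hU _ f g hf hg => hf.eq hU hg,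
    fun P Q hP _ f g hf hg => hf.eq hP 𝓟.κ_sq hg⟩
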